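/- **Theorem 1.2.** Let $g\ge 1$ and let $\Gamma$ be a chain of $g$ cycles: a metric graph made of cycles $C_1,\dots,C_g$ with distinct points $v_i\neq w_i$ chosen on each $C_i$, where $w_i$ is joined to $v_{i+1}$ by a bridge of length $\ge 0$ for $1\le i<g$ (length $0$ means that $w_i$ and $v_{i+1}$ are identified). The marked point is $w_g$, on the rightmost cycle. Let $\ell_i$ be the length of $C_i$ and $\ell(v_iw_i)$ the length of the clockwise edge of $C_i$ from $v_i$ to $w_i$; let $m_i=0$ if $\ell(v_iw_i)/\ell_i$ is irrational, and otherwise let $m_i$ be the least positive integer such that $m_i\,\ell(v_iw_i)$ is an integer multiple of $\ell_i$. For a partition $\lambda=(\lambda_0\ge\lambda_1\ge\cdots)$, identified with the set of boxes $\{(x,y)\in\mathbf Z_{>0}^2 : x\le\lambda_{y-1}\}$, and with $|\lambda|$ the number of its boxes, let $$W^\lambda(\Gamma,w_g)=\{[D]\in\mathrm{Pic}^0(\Gamma) : r(D+d'\cdot w_g)\ge r' \text{ whenever } (g-d'+r',\,r'+1)\in\lambda\},$$ where $r(\cdot)$ is the Baker–Norine rank. The marked metric graph $(\Gamma,w_g)$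 is called *Brill–Noether general* if for every partition $\lambda$ the locus $W^\lambda(\Gamma,w_g)$ is nonempty of dimension $g-|\lambda|$ (as a subset of the real torus $\mathrm{Pic}^0(\Gamma)$) when $g-|\lambda|\ge 0$, and is empty when $g-|\lambda|<0$. Then $(\Gamma,w_g)$ is Brill–Noether general if and only if, for each $i\in\{2,\dots,g\}$, either $m_i=0$ or $m_i>i$. -/

import Mathlib

open scoped Topology

/-- A (compact, connected) metric graph, presented by a finite connected multigraph
(loops and multiple edges allowed) with a positive length on each edge.  The edge `e` is
identified with the interval `[0, len e]`, where `0` is its source and `len e` its target. -/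
structure MetricGraph where
  /-- the vertices -/
  V : Type
  /-- the edges -/
  E : Type
  [finiteV : Finite V]
  [fintypeE : Fintype E]
  src : E → V
  tgt : E → V
  len : E → ℝ
  len_pos : ∀ e, 0 < len e
  nonempty : Nonempty V
  connected : ∀ u v : V, Relation.EqvGen (fun a b => ∃ e, src e = a ∧ tgt e = b) u v

attribute [instance] MetricGraph.finiteV MetricGraph.fintypeE

namespace MetricGraph

noncomputable section

/-- The points of a metric graph: the vertices, and the interior points of the edges. -/
inductive Point (G : MetricGraph) : Type
  | vertex (v : G.V) : Point G
  | interior (e : G.E) (t : ℝ) (h0 : 0 < t) (h1 : t < G.len e) : Point G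

variable (G : MetricGraph)

open Classical in
/-- The point at distance `t` from the source on the edge `e`, for `0 ≤ t ≤ len e`
(outside this range `t` is clamped). -/
def pt (e : G.E) (t : ℝ) : G.Point :=
  if h0 : 0 < t then
    if h1 : t < G.len e then Point.interior e t h0 h1 else Point.vertex (G.tgt e)
  else Point.vertex (G.src e)

/-- The genus (first Betti number) `|E| - |V| + 1`.  As the graph is connected,
`|V| ≤ |E| + 1`, so the subtraction does not truncate. -/
def genus : ℕ := Nat.card G.E + 1 - Nat.card G.V

/-! ### Divisors and linear equivalence -/

/-- Divisors: finite formal integer combinations of points. -/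
abbrev Div : Type := G.Point →₀ ℤ

/-- The degree of a divisor. -/
def deg : G.Div →+ ℤ := Finsupp.liftAddHom fun _ => AddMonoidHom.id ℤ

/-- A rational function on a metric graph: a continuous piecewise linear real function with
integer slopes.  It is recorded together with its outgoing slopes: `right e t` and `left e t` are
the slopes at the point `t` of the edge `e` in the directions of the target and of the source.
The function determines the slopes wherever the corresponding direction exists (the values
elsewhere play no role), and by compactness of the edges there are only finitely many pieces. -/
structure RationalFunction where
  toFun : G.Point → ℝ
  right : G.E → ℝ → ℤ
  left : G.E → ℝ → ℤ
  right_spec : ∀ e t, 0 ≤ t → t < G.len e →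
    ∀ᶠ h in 𝓝[>] (0 : ℝ), toFun (G.pt e (t + h)) = toFun (G.pt e t) + right e t * h
  left_spec : ∀ e t, 0 < t → t ≤ G.len e →
    ∀ᶠ h in 𝓝[>] (0 : ℝ), toFun (G.pt e (t - h)) = toFun (G.pt e t) + left e t * h

variable {G}

open Classical in
/-- The order of a rational function at a point: the sum of its outgoing slopes there. -/
def RationalFunction.ord (f : G.RationalFunction) : G.Point → ℤ
  | .vertex v => ∑ e : G.E, ((if G.src e = v then f.right e 0 else 0) +
      (if G.tgt e = v then f.left e (G.len e) else 0))
  | .interior e t _ _ => f.right e t + f.left e t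

variable (G)

/-- The group of principal divisors `div f = ∑ p, ord_p f • p`. -/
def principal : AddSubgroup G.Div where
  carrier := {D | ∃ f : G.RationalFunction, ∀ p, D p = f.ord p}
  zero_mem' := by
    refine ⟨⟨fun _ => 0, fun _ _ => 0, fun _ _ => 0, ?_, ?_⟩, ?_⟩
    · intro e t _ _; simp
    · intro e t _ _; simp
    · rintro (v | ⟨e, t, h0, h1⟩) <;> simp [RationalFunction.ord]
  add_mem' := by
    rintro D D' ⟨f, hf⟩ ⟨f', hf'⟩
    refine ⟨⟨fun p => f.toFun p + f'.toFun p, fun e t => f.right e t + f'.right e t,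
      fun e t => f.left e t + f'.left e t, ?_, ?_⟩, ?_⟩
    · intro e t h0 h1
      filter_upwards [f.right_spec e t h0 h1, f'.right_spec e t h0 h1] with h a b
      rw [a, b]; push_cast; ring
    · intro e t h0 h1
      filter_upwards [f.left_spec e t h0 h1, f'.left_spec e t h0 h1] with h a b
      rw [a, b]; push_cast; ring
    · rintro (v | ⟨e, t, h0, h1⟩)
      · rw [Finsupp.add_apply, hf, hf']
        simp only [RationalFunction.ord]
        rw [← Finset.sum_add_distrib]
        refine Finset.sum_congr rfl fun e _ => ?_
        split_ifs <;> ring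
      · rw [Finsupp.add_apply, hf, hf']
        simp only [RationalFunction.ord]
        ring
  neg_mem' := by
    rintro D ⟨f, hf⟩
    refine ⟨⟨fun p => - f.toFun p, fun e t => - f.right e t,
      fun e t => - f.left e t, ?_, ?_⟩, ?_⟩
    · intro e t h0 h1
      filter_upwards [f.right_spec e t h0 h1] with h a
      rw [a]; push_cast; ring
    · intro e t h0 h1
      filter_upwards [f.left_spec e t h0 h1] with h a
      rw [a]; push_cast; ring
    · rintro (v | ⟨e, t, h0, h1⟩)
      · rw [Finsupp.neg_apply, hf]
        simp only [RationalFunction.ord]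
        rw [← Finset.sum_neg_distrib]
        refine Finset.sum_congr rfl fun e _ => ?_
        split_ifs <;> ring
      · rw [Finsupp.neg_apply, hf]
        simp only [RationalFunction.ord]
        ring

/-- The divisors of degree `0`. -/
def Div0 : AddSubgroup G.Div := G.deg.ker

/-- `Pic⁰`: the group of divisor classes of degree `0`. -/
abbrev Pic0 : Type := G.Div0 ⧸ (G.principal.addSubgroupOf G.Div0)

variable {G}

/-- Linear equivalence of divisors. -/
def LinEquiv (D D' : G.Div) : Prop := D - D' ∈ G.principal

/-- `RankAtLeast D r` says that the Baker-Norine rank of `D` is at least `r`: for every effective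
divisor `A` of degree `r`, the divisor `D - A` is linearly equivalent to an effective one. -/
def RankAtLeast (D : G.Div) (r : ℕ) : Prop :=
  ∀ A : G.Div, 0 ≤ A → G.deg A = r → ∃ B : G.Div, 0 ≤ B ∧ LinEquiv (D - A) B

/-- The Brill-Noether locus `W^lam(G, w)` in `Pic⁰`: the classes of those `D` such that
`r(D + d' w) ≥ r'` whenever the box `(x, y) = (g - d' + r', r' + 1)` belongs to `lam`.
Mathlib's cell `(i, j)` (row `i`, column `j`, counted from `0`) is the box `(x, y) = (j + 1, i + 1)`,
so that `r' = i` and `d' = g + i - j - 1`. -/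
def brillNoetherLocus (w : G.Point) (lam : YoungDiagram) : Set G.Pic0 :=
  {x | ∃ D : G.Div0, (QuotientAddGroup.mk D : G.Pic0) = x ∧ ∀ i j : ℕ, (i, j) ∈ lam →
    RankAtLeast ((D : G.Div) + Finsupp.single w ((G.genus : ℤ) + i - j - 1)) i}

/-! ### The Jacobian, and dimensions of subsets of `Pic⁰` -/

variable (G)

/-- The real vector space `Ω` of harmonic 1-forms, of dimension the genus.  A form is `ω e dx`
on each edge `e`, with inflow equal to outflow at each vertex. -/
def harmonicForms : Submodule ℝ (G.E → ℝ) where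
  carrier := by
    classical exact {ω | ∀ v : G.V, ∑ e : G.E, (if G.tgt e = v then ω e else 0) =
      ∑ e : G.E, (if G.src e = v then ω e else 0)}
  zero_mem' := by intro v; simp
  add_mem' := by
    intro a b ha hb v
    have h1 := ha v
    have h2 := hb v
    simp only [Pi.add_apply, ite_add_zero, Finset.sum_add_distrib]
    rw [h1, h2]
  smul_mem' := by
    intro c a ha v
    have h1 := ha v
    simp only [Pi.smul_apply, smul_eq_mul]
    simp only [← mul_ite_zero, ← Finset.mul_sum]
    rw [h1]

/-- An oriented segment inside an edge, running from the point `a` to the point `b` of it. -/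
structure Segment where
  e : G.E
  a : ℝ
  b : ℝ
  ha : a ∈ Set.Icc 0 (G.len e)
  hb : b ∈ Set.Icc 0 (G.len e)

variable {G}

/-- The boundary of an integral 1-chain (a formal integer combination of segments). -/
def chainBoundary (c : G.Segment →₀ ℤ) : G.Div :=
  c.sum fun s k => k • (Finsupp.single (G.pt s.e s.b) 1 - Finsupp.single (G.pt s.e s.a) 1)

/-- The integral `∫_c ω` of a harmonic 1-form over an integral 1-chain. -/
def chainIntegral (c : G.Segment →₀ ℤ) (ω : G.harmonicForms) : ℝ :=
  c.sum fun s k => (k : ℝ) * ((s.b - s.a) * (ω : G.E → ℝ) s.e)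

/-- The Jacobian of `G` is the real torus `Ω* / H₁(G, ℤ)`, and the Abel-Jacobi isomorphism
`Pic⁰ ≃ Ω* / H₁(G, ℤ)` sends the class of `∂c` to that of the functional `ω ↦ ∫_c ω`.
For a subset `S` of `Pic⁰`, `jacobianLift S` is the preimage in the universal cover `Ω*` of the
image of `S` in the Jacobian. -/
def jacobianLift (S : Set G.Pic0) : Set (StrongDual ℝ G.harmonicForms) :=
  {φ | ∃ (c : G.Segment →₀ ℤ) (D : G.Div0), chainBoundary c = (D : G.Div) ∧
    (QuotientAddGroup.mk D : G.Pic0) ∈ S ∧ ∀ ω, φ ω = chainIntegral c ω}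

/-- The dimension of a subset of the real torus `Pic⁰`: the Hausdorff dimension of its preimage in
the universal cover, a finite-dimensional real vector space.  (The choice of norm is immaterial;
for a closed polyhedral set this is the usual dimension.) -/
def picDim (S : Set G.Pic0) : ENNReal := dimH (jacobianLift S)

/-- The marked metric graph `(G, w)` is Brill-Noether general: for every partition `lam`, the locus
`W^lam(G, w)` has dimension `g - |lam|` (in particular it is nonempty) if this number is
nonnegative, and is empty otherwise. -/
def IsBrillNoetherGeneral (G : MetricGraph) (w : G.Point) : Prop :=
  ∀ lam : YoungDiagram,
    (lam.card ≤ G.genus → (brillNoetherLocus w lam).Nonempty ∧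
      picDim (brillNoetherLocus w lam) = ((G.genus - lam.card : ℕ) : ENNReal)) ∧
    (G.genus < lam.card → brillNoetherLocus w lam = ∅)

end

end MetricGraph

/-- The edge lengths of a chain of `g = n + 1` cycles.  On the `i`th cycle there are two distinct
points `v i` and `w i`, and `top i`, `bot i` are the lengths of the clockwise edges from `v i` to
`w i` and from `w i` to `v i`.  A bridge of length `bridge j` joins `w j` to `v (j + 1)`; this
length may be `0`, in which case the two points coincide. (Cycles are counted from `0`.) -/
structure ChainOfCycles (n : ℕ) where
  top : Fin (n + 1) → ℝ
  bot : Fin (n + 1) → ℝ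
  bridge : Fin n → ℝ
  top_pos : ∀ i, 0 < top i
  bot_pos : ∀ i, 0 < bot i
  bridge_nonneg : ∀ j, 0 ≤ bridge j

namespace ChainOfCycles

variable {n : ℕ}

/-- The vertices of the chain: the first point `v 0`, all points `w i`, and the points
`v (j + 1)` at the end of a bridge of positive length. -/
inductive Vertex (Γ : ChainOfCycles n) : Type
  | start : Vertex Γ
  | right (i : Fin (n + 1)) : Vertex Γ
  | left (j : Fin n) (h : 0 < Γ.bridge j) : Vertex Γ

/-- The edges of the chain: two for each cycle, and the bridges of positive length. -/
inductive Edge (Γ : ChainOfCycles n) : Type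
  | top (i : Fin (n + 1)) : Edge Γ
  | bot (i : Fin (n + 1)) : Edge Γ
  | bridge (j : Fin n) (h : 0 < Γ.bridge j) : Edge Γ

variable (Γ : ChainOfCycles n)

instance : Finite Γ.Vertex := by
  refine Finite.of_injective (β := Option (Fin (n + 1) ⊕ Fin n))
    (fun x => match x with
      | .start => none
      | .right i => some (.inl i)
      | .left j _ => some (.inr j)) ?_
  rintro (_ | _ | _) (_ | _ | _) h <;> simp_all

instance : Finite Γ.Edge := by
  refine Finite.of_injective (β := Fin (n + 1) ⊕ Fin (n + 1) ⊕ Fin n)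
    (fun x => match x with
      | .top i => .inl i
      | .bot i => .inr (.inl i)
      | .bridge j _ => .inr (.inr j)) ?_
  rintro (_ | _ | _) (_ | _ | _) h <;> simp_all

noncomputable section

/-- The right point `w i` of the `i`th cycle. -/
def w (i : Fin (n + 1)) : Γ.Vertex := .right i

open Classical in
/-- The left point `v i` of the `i`th cycle; `v (j + 1)` is `w j` if the bridge between them has
length `0`. -/
def v : Fin (n + 1) → Γ.Vertex :=
  Fin.cases .start fun j => if h : 0 < Γ.bridge j then .left j h else .right j.castSucc

/-- The starting point of an edge. -/
def src : Γ.Edge → Γ.Vertex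
  | .top i => Γ.v i
  | .bot i => Γ.w i
  | .bridge j _ => Γ.w j.castSucc

/-- The end point of an edge. -/
def tgt : Γ.Edge → Γ.Vertex
  | .top i => Γ.w i
  | .bot i => Γ.v i
  | .bridge j _ => Γ.v j.succ

/-- The length of an edge. -/
def len : Γ.Edge → ℝ
  | .top i => Γ.top i
  | .bot i => Γ.bot i
  | .bridge j _ => Γ.bridge j

/-- The chain of cycles as a metric graph. -/
def toMetricGraph : MetricGraph where
  V := Γ.Vertex
  E := Γ.Edge
  fintypeE := Fintype.ofFinite _
  src := Γ.src
  tgt := Γ.tgt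
  len := Γ.len
  len_pos := by
    rintro (i | i | ⟨j, h⟩)
    · exact Γ.top_pos i
    · exact Γ.bot_pos i
    · exact h
  nonempty := ⟨.start⟩
  connected := by
    have hvw : ∀ i, Relation.EqvGen (fun a b => ∃ e, Γ.src e = a ∧ Γ.tgt e = b) (Γ.v i) (Γ.w i) :=
      fun i => .rel _ _ ⟨.top i, rfl, rfl⟩
    have hwv : ∀ j : Fin n, Relation.EqvGen (fun a b => ∃ e, Γ.src e = a ∧ Γ.tgt e = b)
        (Γ.w j.castSucc) (Γ.v j.succ) := by
      intro j
      by_cases h : 0 < Γ.bridge j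
      · exact .rel _ _ ⟨.bridge j h, rfl, rfl⟩
      · have : Γ.v j.succ = Γ.w j.castSucc := by simp [v, w, h]
        rw [this]
        exact .refl _
    have hv : ∀ i, Relation.EqvGen (fun a b => ∃ e, Γ.src e = a ∧ Γ.tgt e = b)
        .start (Γ.v i) := by
      intro i
      induction i using Fin.induction with
      | zero => exact .refl _
      | succ j ih => exact (ih.trans _ _ _ (hvw _)).trans _ _ _ (hwv j)
    have key : ∀ x, Relation.EqvGen (fun a b => ∃ e, Γ.src e = a ∧ Γ.tgt e = b) .start x := by
      rintro (_ | i | ⟨j, h⟩)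
      · exact .refl _
      · exact (hv i).trans _ _ _ (hvw i)
      · have : Γ.v j.succ = .left j h := by simp [v, h]
        rw [← this]
        exact hv _
    exact fun x y => ((key x).symm _ _).trans _ _ _ (key y)

/-- The marked point `w_g`, on the rightmost cycle. -/
def markedPoint : Γ.toMetricGraph.Point := .vertex (Γ.w (Fin.last n))

open Classical in
/-- The torsion order of the `i`th cycle: `0` if `ℓ(v i, w i)` is an irrational multiple of the
length `ℓ i` of the cycle, and otherwise the least positive integer `m` such that
`m * ℓ(v i, w i)` is an integer multiple of `ℓ i`. -/
def torsionOrder (i : Fin (n + 1)) : ℕ :=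
  if Irrational (Γ.top i / (Γ.top i + Γ.bot i)) then 0
  else sInf {m : ℕ | 0 < m ∧ ∃ k : ℤ, (m : ℝ) * Γ.top i = k * (Γ.top i + Γ.bot i)}

end

end ChainOfCycles

/-! A divisor class of degree 0 has one coordinate on each cycle, modulo the length of that cycle,
and these coordinates determine it: this is the Abel-Jacobi theorem for the chain
(`mem_principal_iff`). If a class of any degree is moved to degree 0 by a multiple of the rightmost
point, then chips to the right of a cycle do not affect the coordinate there. Effectiveness and rank
can therefore be computed one cycle at a time (`rankGE_succ`, `rankAtLeast_iff`). In terms of the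
boxes (i, j) for which D + (g + i - j - 1)w has rank at least i, the recursion is displacement of
diagrams: each new cycle adds all addable boxes whose diagonals lie in one residue class modulo its
torsion order, the class being prescribed by the coordinate (`rankGE_iff_inDiagram`).

Suppose that the torsion orders are 0 or large. Two boxes added together by cycle n + 1 would lie on
diagonals at least n + 2 apart, and the old diagram would contain the n + 1 or more boxes of a path
running between them; but n cycles that each add at most one box yield at most n boxes
(`diagram_succ_diff_subsingleton`). Hence every partition inside the diagram carries an injective
tableau. Each box then confines the coordinate of its own cycle to countably many values, which
bounds the dimension by g - |lam| and excludes partitions with more than g boxes. The opposite bound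
holds on every chain: a standard tableau gives an affine coordinate subspace of codimension |lam|
inside the locus (`exists_affine_subset_coordLocus`).

Conversely, let cycle i have torsion order m with 2 ≤ m ≤ i; the order 1 cannot occur, since v and w
are distinct. The hook with rows m and 1 has its two corners m diagonals apart, so cycle i can add
both at once. The other m - 1 boxes are added by earlier cycles, so that m conditions produce m + 1
boxes and the locus is too large (`exists_affine_subset_coordLocus_hook`). -/

namespace ChainClass

/-! ### Effective classes and ranks in coordinates -/

variable {A : Type*} [AddCommGroup A] (H : ℕ → AddSubgroup A) (τ : ℕ → A)

/-- The classes of effective divisors of degree `e` on a chain of `n` cycles, the `k`th cycle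
having the group of points `A ⧸ H k`, with left point `0` and right point `τ k`.  The class is given
by the coordinates `η k` of its translate to degree `0` by a multiple of the rightmost point. -/
def IsEffective : ℕ → ℤ → (ℕ → A) → Prop
  | 0, e, _ => 0 ≤ e
  -- `b` counts the chips on the last cycle. A single chip already realises any coordinate there;
  -- without one, all chips retract to the left point, whose coordinate is 0. Chips on the last
  -- cycle retract to the right point of earlier cycles, so the normalised `η` is unchanged on
  -- those.
  | n + 1, e, η => ∃ b : ℕ, IsEffective n (e - b) η ∧ (b = 0 → η n + e • τ n ∈ H n)

variable {H τ}

lemma IsEffective.congr {n : ℕ} {e : ℤ} {η η' : ℕ → A} (h : IsEffective H τ n e η)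
    (hη : ∀ k < n, η' k - η k ∈ H k) : IsEffective H τ n e η' := by
  induction n generalizing e with
  | zero => exact h
  | succ n ih =>
    obtain ⟨b, h1, h2⟩ := h
    refine ⟨b, ih h1 fun k hk => hη k (by omega), fun hb => ?_⟩
    have := (H n).add_mem (hη n (by omega)) (h2 hb)
    convert this using 1
    abel

lemma IsEffective.add_one {n : ℕ} {e : ℤ} {η : ℕ → A} (h : IsEffective H τ n e η) :
    IsEffective H τ n (e + 1) η := by
  cases n with
  | zero => simp only [IsEffective] at h ⊢; omega
  | succ n =>
    obtain ⟨b, h1, -⟩ := h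
    refine ⟨b + 1, ?_, by simp⟩
    convert h1 using 1
    push_cast; ring

lemma IsEffective.mono {n : ℕ} {e e' : ℤ} {η : ℕ → A} (h : IsEffective H τ n e η) (he : e ≤ e') :
    IsEffective H τ n e' η := by
  induction e', he using Int.leInduction with
  | base => exact h
  | succ m _ ih => exact ih.add_one

lemma IsEffective.nonneg {n : ℕ} {e : ℤ} {η : ℕ → A} (h : IsEffective H τ n e η) : 0 ≤ e := by
  induction n generalizing e with
  | zero => exact h
  | succ n ih =>
    obtain ⟨b, h1, -⟩ := h
    have := ih h1
    omega

lemma IsEffective.add {n : ℕ} {e e' : ℤ} {η η' : ℕ → A} (h : IsEffective H τ n e η)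
    (h' : IsEffective H τ n e' η') : IsEffective H τ n (e + e') (η + η') := by
  induction n generalizing e e' with
  | zero => simp only [IsEffective] at h h' ⊢; omega
  | succ n ih =>
    obtain ⟨b, h1, h2⟩ := h
    obtain ⟨b', h1', h2'⟩ := h'
    refine ⟨b + b', ?_, fun hb => ?_⟩
    · convert ih h1 h1' using 1
      push_cast; ring
    · convert (H n).add_mem (h2 (by omega)) (h2' (by omega)) using 1
      simp only [Pi.add_apply, add_smul]
      abel

/-- By monotonicity in the degree, more than one chip on the last cycle is never needed. -/
lemma isEffective_succ {n : ℕ} {e : ℤ} {η : ℕ → A} : IsEffective H τ (n + 1) e η ↔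
    IsEffective H τ n (e - 1) η ∨ (η n + e • τ n ∈ H n ∧ IsEffective H τ n e η) := by
  constructor
  · rintro ⟨b, h1, h2⟩
    rcases Nat.eq_zero_or_pos b with rfl | hb
    · exact Or.inr ⟨h2 rfl, by simpa using h1⟩
    · exact Or.inl (h1.mono (by omega))
  · rintro (h | ⟨h1, h2⟩)
    · exact ⟨1, by simpa using h, by simp⟩
    · exact ⟨0, by simpa using h2, fun _ => h1⟩

lemma isEffective_zero (n : ℕ) : IsEffective H τ n 0 0 := by
  induction n with
  | zero => exact le_rfl
  | succ n ih => exact ⟨0, by simpa using ih, fun _ => by simp⟩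

variable (H τ)

/-- The Baker-Norine rank of a class of degree `e` is at least `r`. -/
def RankGE (n : ℕ) (e : ℤ) (η : ℕ → A) (r : ℕ) : Prop :=
  ∀ ζ, IsEffective H τ n r ζ → IsEffective H τ n (e - r) (η - ζ)

variable {H τ}

lemma RankGE.add_one {n : ℕ} {e : ℤ} {η : ℕ → A} {r : ℕ} (h : RankGE H τ n e η r) :
    RankGE H τ n (e + 1) η r := fun ζ hζ => (h ζ hζ).mono (by omega)

lemma RankGE.pred {n : ℕ} {e : ℤ} {η : ℕ → A} {r : ℕ} (h : RankGE H τ n e η (r + 1)) :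
    RankGE H τ n (e - 1) η r := fun ζ hζ => (h ζ (by simpa using hζ.add_one)).mono (by
  push_cast; omega)

/-- The subtracted divisor either avoids the last cycle, giving the disjunction, or has a chip
there. That chip can be placed so that the difference also needs a chip there, which costs two
degrees and one unit of rank. -/
lemma rankGE_succ (hH : ∀ k, H k ≠ ⊤) {n : ℕ} {e : ℤ} {η : ℕ → A} {r : ℕ} :
    RankGE H τ (n + 1) e η r ↔
      (RankGE H τ n (e - 1) η r ∨ (η n + e • τ n ∈ H n ∧ RankGE H τ n e η r)) ∧
        ∀ r', r = r' + 1 → RankGE H τ n (e - 2) η r' := by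
  have ext : ∀ (ζ : ℕ → A) (z : A) (f : ℤ), IsEffective H τ n f ζ →
      IsEffective H τ n f (Function.update ζ n z) := fun ζ z f h => h.congr fun k hk => by
    rw [Function.update_of_ne (by omega)]; simp
  have unext : ∀ (ζ : ℕ → A) (z : A) (f : ℤ), IsEffective H τ n f (η - Function.update ζ n z) →
      IsEffective H τ n f (η - ζ) := fun ζ z f h => h.congr fun k hk => by
    simp [Function.update_of_ne (show k ≠ n by omega)]
  constructor
  · intro h
    refine ⟨?_, ?_⟩
    · have key : ∀ ζ, IsEffective H τ n r ζ → IsEffective H τ n (e - r - 1) (η - ζ) ∨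
          (η n + e • τ n ∈ H n ∧ IsEffective H τ n (e - r) (η - ζ)) := by
        intro ζ hζ
        -- This last coordinate allows all `r` subtracted chips to lie on the earlier cycles. The
        -- membership condition that comes out does not depend on `ζ`, so one alternative serves for
        -- all `ζ`.
        have h1 := h (Function.update ζ n (-((r : ℤ) • τ n)))
          (isEffective_succ.2 (Or.inr ⟨by simp, ext _ _ _ hζ⟩))
        rcases isEffective_succ.1 h1 with h2 | ⟨h2, h3⟩
        · exact Or.inl (unext _ _ _ h2)
        · refine Or.inr ⟨?_, unext _ _ _ h3⟩
          convert h2 using 1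
          simp [sub_smul]
      by_cases hη : η n + e • τ n ∈ H n
      · refine Or.inr ⟨hη, fun ζ hζ => ?_⟩
        rcases key ζ hζ with h1 | h1
        · exact h1.mono (by omega)
        · exact h1.2
      · refine Or.inl fun ζ hζ => ?_
        rcases key ζ hζ with h1 | h1
        · exact h1.mono (by omega)
        · exact absurd h1.1 hη
    · rintro r rfl ζ hζ
      obtain ⟨y, hy⟩ : ∃ y, y ∉ H n := by
        by_contra! hc
        exact hH n ((AddSubgroup.eq_top_iff' _).2 hc)
      -- Chosen so that the difference has the coordinate `y ∉ H n` on the last cycle, where an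
      -- effective representative must then have a chip.
      have h1 := h (Function.update ζ n (η n + e • τ n - y - ((r + 1 : ℕ) : ℤ) • τ n))
        (isEffective_succ.2 (Or.inl (ext _ _ _ (by simpa using hζ))))
      rcases isEffective_succ.1 h1 with h2 | ⟨h2, h3⟩
      · exact (unext _ _ _ h2).mono (by push_cast; omega)
      · refine absurd ?_ hy
        convert h2 using 1
        simp [sub_smul]
        abel
  · rintro ⟨h1, h2⟩ ζ ⟨b, hb1, hb2⟩
    rcases Nat.eq_zero_or_pos b with rfl | hb
    · simp only [Nat.cast_zero, sub_zero] at hb1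
      refine isEffective_succ.2 ?_
      rcases h1 with h1 | ⟨h1, h3⟩
      · exact Or.inl ((h1 ζ hb1).mono (by omega))
      · refine Or.inr ⟨?_, h3 ζ hb1⟩
        convert (H n).sub_mem h1 (hb2 rfl) using 1
        simp [sub_smul]
        abel
    · have h3 := hb1.nonneg
      obtain ⟨r, rfl⟩ : ∃ r', r = r' + 1 := ⟨r - 1, by omega⟩
      refine isEffective_succ.2 (Or.inl ?_)
      exact (h2 r rfl ζ (hb1.mono (by push_cast; omega))).mono (by push_cast; omega)

/-! ### The diagram of a class -/

variable (H τ)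

/-- The boxes `(i, j)` (row `i`, column `j`) of the partition of a class of degree `0` on a chain of
`n` cycles.  The `n`th cycle adds all addable boxes whose diagonal lies in a residue class. -/
def InDiagram : ℕ → (ℕ → A) → ℕ → ℤ → Prop
  -- Negative columns count as filled, so that column 0 needs no separate case in the recursion.
  | 0, _, _, j => j < 0
  | n + 1, η, i, j => InDiagram n η i j ∨ (η n + ((n : ℤ) + i - j) • τ n ∈ H n ∧
      InDiagram n η i (j - 1) ∧ ∀ i', i = i' + 1 → InDiagram n η i' j)

variable {H τ}

/-- With `e = n + i - j`, the degree for `n + 1` cycles, the three rank conditions in `rankGE_succ`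
are those of the boxes `(i, j)`, `(i, j - 1)` and `(i - 1, j)` for `n` cycles. -/
theorem rankGE_iff_inDiagram (hH : ∀ k, H k ≠ ⊤) (n : ℕ) (η : ℕ → A) (i : ℕ) (j : ℤ) :
    RankGE H τ n (n + i - j - 1) η i ↔ InDiagram H τ n η i j := by
  induction n generalizing i j with
  | zero =>
    simp only [RankGE, IsEffective, InDiagram]
    constructor
    · intro h; have := h 0 (by omega); push_cast at this; omega
    · intro h _ _; push_cast; omega
  | succ n ih =>
    rw [rankGE_succ hH, InDiagram, ← ih i j, ← ih i (j - 1)]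
    rw [show (((n + 1 : ℕ) : ℤ) + i - j - 1) - 1 = n + i - j - 1 by push_cast; ring,
      show (((n + 1 : ℕ) : ℤ) + i - j - 1) = n + i - j by push_cast; ring,
      show (n : ℤ) + i - (j - 1) - 1 = n + i - j by ring]
    have h3 : (∀ r', i = r' + 1 → RankGE H τ n ((n : ℤ) + i - j - 2) η r') ↔
        ∀ i', i = i' + 1 → InDiagram H τ n η i' j := by
      refine forall_congr' fun i' => forall_congr' fun hi => ?_
      rw [← ih i' j, hi]
      push_cast
      rw [show (n : ℤ) + (i' + 1) - j - 2 = n + i' - j - 1 by ring]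
    rw [h3]
    constructor
    · rintro ⟨h1 | h1, h2⟩
      · exact Or.inl h1
      · exact Or.inr ⟨h1.1, h1.2, h2⟩
    · rintro (h1 | h1)
      · refine ⟨Or.inl h1, ?_⟩
        rintro i' rfl
        rw [← ih i' j]
        convert h1.pred using 1
        push_cast; ring
      · exact ⟨Or.inr ⟨h1.1, h1.2.1⟩, h1.2.2⟩

lemma InDiagram.succ {n : ℕ} {η : ℕ → A} {i : ℕ} {j : ℤ} (h : InDiagram H τ n η i j) :
    InDiagram H τ (n + 1) η i j := Or.inl h

lemma InDiagram.mono {n n' : ℕ} {η : ℕ → A} {i : ℕ} {j : ℤ} (h : InDiagram H τ n η i j)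
    (hn : n ≤ n') : InDiagram H τ n' η i j := by
  induction n', hn using Nat.le_induction with
  | base => exact h
  | succ _ _ ih => exact ih.succ

lemma inDiagram_of_neg (n : ℕ) (η : ℕ → A) (i : ℕ) {j : ℤ} (hj : j < 0) :
    InDiagram H τ n η i j := InDiagram.mono (n := 0) hj (Nat.zero_le n)

/-- Removing a point lowers the rank by at most one, and adding a point does not lower it. -/
lemma InDiagram.of_le (hH : ∀ k, H k ≠ ⊤) {n : ℕ} {η : ℕ → A} {i i' : ℕ} {j j' : ℤ}
    (h : InDiagram H τ n η i j) (hi : i' ≤ i) (hj : j' ≤ j) : InDiagram H τ n η i' j' := by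
  have h1 : InDiagram H τ n η i' j := by
    induction i, hi using Nat.le_induction with
    | base => exact h
    | succ i _ ih =>
      refine ih ?_
      rw [← rankGE_iff_inDiagram hH] at h ⊢
      convert h.pred using 1
      push_cast; ring
  induction j, hj using Int.leInduction with
  | base => exact h1
  | succ j _ ih =>
    have h2 : ∀ i, InDiagram H τ n η i (j + 1) → InDiagram H τ n η i j := by
      intro i h
      rw [← rankGE_iff_inDiagram hH] at h ⊢
      convert h.add_one using 1
      ring
    exact ih (h2 _ h) (h2 _ h1)

lemma InDiagram.congr {n : ℕ} {η η' : ℕ → A} {i : ℕ} {j : ℤ} (h : InDiagram H τ n η i j)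
    (hη : ∀ k < n, η' k - η k ∈ H k) : InDiagram H τ n η' i j := by
  induction n generalizing i j with
  | zero => exact h
  | succ n ih =>
    have hη' : ∀ k < n, η' k - η k ∈ H k := fun k hk => hη k (by omega)
    rcases h with h | ⟨h1, h2, h3⟩
    · exact Or.inl (ih h hη')
    · refine Or.inr ⟨?_, ih h2 hη', fun i' hi => ih (h3 i' hi) hη'⟩
      convert (H n).add_mem (hη n (by omega)) h1 using 1
      abel

/-! ### Tableaux and the number of boxes -/

/-- A displacement tableau on `lam` forces `lam` into the diagram. -/
lemma inDiagram_of_tableau {g : ℕ} {η : ℕ → A} {lam : YoungDiagram} (t : ℕ → ℕ → ℕ)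
    (hg : ∀ i j, (i, j) ∈ lam → t i j < g)
    (hrow : ∀ i j, (i, j + 1) ∈ lam → t i j < t i (j + 1))
    (hcol : ∀ i j, (i + 1, j) ∈ lam → t i j < t (i + 1) j)
    (hη : ∀ i j, (i, j) ∈ lam →
      η (t i j) + ((t i j : ℤ) + i - j) • τ (t i j) ∈ H (t i j))
    (i j : ℕ) (hij : (i, j) ∈ lam) : InDiagram H τ g η i j := by
  -- A box with entry `k` is added by cycle `k` at the latest; its neighbours above and to the left
  -- have smaller entries and are already present.
  suffices h : ∀ k i j, (i, j) ∈ lam → t i j < k → InDiagram H τ k η i j from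
    h g i j hij (hg i j hij)
  intro k
  induction k with
  | zero => intro i j _ h; omega
  | succ k ih =>
    intro i j hij hk
    rcases Nat.lt_succ_iff_lt_or_eq.1 hk with h | h
    · exact (ih i j hij h).succ
    refine Or.inr ⟨h ▸ hη i j hij, ?_, ?_⟩
    · cases j with
      | zero => exact inDiagram_of_neg _ _ _ (by simp)
      | succ j =>
        have h1 := ih i j (lam.up_left_mem le_rfl (Nat.le_succ j) hij) (h ▸ hrow i j hij)
        convert h1 using 1
        push_cast; ring
    · rintro i' rfl
      exact ih i' j (lam.up_left_mem (Nat.le_succ i') le_rfl hij) (h ▸ hcol i' j hij)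

variable (H τ) in
/-- The boxes in nonnegative columns of the diagram. -/
def diagram (n : ℕ) (η : ℕ → A) : Set (ℕ × ℕ) := {p | InDiagram H τ n η p.1 p.2}

/-- If the torsion orders are large, then each cycle adds at most one box. -/
lemma diagram_succ_diff_subsingleton (hH : ∀ k, H k ≠ ⊤) {η : ℕ → A} {n : ℕ}
    (hτ : ∀ c : ℤ, c ≠ 0 → c • τ n ∈ H n → (n : ℤ) + 2 ≤ |c|)
    (hn : (diagram H τ n η).encard ≤ n) :
    (diagram H τ (n + 1) η \ diagram H τ n η).Subsingleton := by
  have key : ∀ p ∈ diagram H τ (n + 1) η \ diagram H τ n η,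
      ∀ q ∈ diagram H τ (n + 1) η \ diagram H τ n η, ¬ p.1 < q.1 := by
    rintro ⟨i, j⟩ ⟨hp1, hp2⟩ ⟨i', j'⟩ ⟨hq1, hq2⟩ hlt
    simp only [diagram, Set.mem_ofPred_eq] at hp1 hp2 hq1 hq2 hlt
    obtain ⟨a1, a2, -⟩ := hp1.resolve_left hp2
    obtain ⟨b1, -, b3⟩ := hq1.resolve_left hq2
    have b3' := b3 (i' - 1) (by omega)
    -- Otherwise `(i, j)` would be dominated by `(i' - 1, j')`, a box of the old diagram.
    have hj : j' < j := by
      by_contra! hc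
      exact hp2 (b3'.of_le hH (by omega) (by omega))
    -- Both boxes satisfy the congruence of the same cycle, so the difference of their diagonals is
    -- a torsion multiple.
    have hc := hτ (((j : ℤ) - j') + (i' - i)) (by omega) (by
      convert (H n).sub_mem b1 a1 using 1
      rw [add_sub_add_left_eq_sub, ← sub_smul]
      congr 1; ring)
    rw [abs_of_pos (by omega)] at hc
    -- The path along row `i` and column `j'` from one new box to the other, without its ends: it
    -- lies in the old diagram and has one box fewer than the difference of diagonals, hence at
    -- least `n + 1`.
    let S : Finset (ℕ × ℕ) :=
      (Finset.Ico j' j).map ⟨fun y => (i, y), fun a b h => by simpa using h⟩ ∪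
      (Finset.Ioo i i').map ⟨fun x => (x, j'), fun a b h => by simpa using h⟩
    have hS : S.card = (j - j') + (i' - i - 1) := by
      rw [Finset.card_union_of_disjoint]
      · simp
      · rw [Finset.disjoint_left]
        rintro ⟨x, y⟩ h1 h2
        obtain ⟨a, h1, h1'⟩ := Finset.mem_map.1 h1
        obtain ⟨b, h2, h2'⟩ := Finset.mem_map.1 h2
        have h3 : i = b := (congrArg Prod.fst h1').trans (congrArg Prod.fst h2').symm
        rw [Finset.mem_Ioo] at h2
        omega
    have hSub : (S : Set (ℕ × ℕ)) ⊆ diagram H τ n η := by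
      rintro ⟨x, y⟩ h
      simp only [S, Finset.mem_coe, Finset.mem_union, Finset.mem_map] at h
      obtain ⟨a, h1, h⟩ | ⟨a, h1, h⟩ := h <;>
      · obtain ⟨rfl, rfl⟩ := Prod.mk.inj h
        simp at h1
        simp only [diagram, Set.mem_ofPred_eq]
        first
          | exact a2.of_le hH le_rfl (by omega)
          | exact b3'.of_le hH (by omega) le_rfl
    have := (Set.encard_le_encard hSub).trans hn
    rw [Set.encard_coe_eq_coe_finsetCard, hS] at this
    have := ENat.natCast_le_natCast.1 this
    omega
  rintro ⟨i, j⟩ hp ⟨i', j'⟩ hq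
  have e1 : i = i' := le_antisymm (not_lt.1 (key _ hq _ hp)) (not_lt.1 (key _ hp _ hq))
  subst e1
  have key2 : ∀ j j', (i, j) ∈ diagram H τ (n + 1) η \ diagram H τ n η →
      (i, j') ∈ diagram H τ (n + 1) η \ diagram H τ n η → ¬ j < j' := by
    rintro j j' ⟨-, hp2⟩ ⟨hq1, hq2⟩ hlt
    simp only [diagram, Set.mem_ofPred_eq] at hp2 hq1 hq2 hlt
    obtain ⟨-, b2, -⟩ := hq1.resolve_left hq2
    exact hp2 (b2.of_le hH le_rfl (by omega))
  rw [le_antisymm (not_lt.1 (key2 _ _ hq hp)) (not_lt.1 (key2 _ _ hp hq))]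

lemma encard_diagram_le (hH : ∀ k, H k ≠ ⊤) {η : ℕ → A} {g n : ℕ} (hn : n ≤ g)
    (hτ : ∀ k < g, ∀ c : ℤ, c ≠ 0 → c • τ k ∈ H k → (k : ℤ) + 2 ≤ |c|) :
    (diagram H τ n η).encard ≤ n := by
  induction n with
  | zero =>
    have : diagram H τ 0 η = ∅ := by
      ext ⟨i, j⟩
      simp [diagram, InDiagram]
    simp [this]
  | succ n ih =>
    have h1 := ih (by omega)
    have h2 := diagram_succ_diff_subsingleton hH (hτ n (by omega)) h1
    calc (diagram H τ (n + 1) η).encard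
        ≤ (diagram H τ (n + 1) η \ diagram H τ n η).encard + (diagram H τ n η).encard :=
          Set.encard_le_encard_sdiff_add_encard _ _
      _ ≤ 1 + n := add_le_add (Set.encard_le_one_iff_subsingleton.2 h2) h1
      _ = ((n + 1 : ℕ) : ℕ∞) := by push_cast; ring

/-- If the torsion orders are large, then a partition contained in the diagram carries an
injective tableau. -/
lemma exists_injective_tableau (hH : ∀ k, H k ≠ ⊤) {η : ℕ → A} {g : ℕ} {lam : YoungDiagram}
    (hτ : ∀ k < g, ∀ c : ℤ, c ≠ 0 → c • τ k ∈ H k → (k : ℤ) + 2 ≤ |c|)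
    (hlam : ∀ i j, (i, j) ∈ lam → InDiagram H τ g η i j) :
    ∃ t : lam.cells → Fin g, Function.Injective t ∧ ∀ b : lam.cells,
      η (t b) + ((t b : ℤ) + b.1.1 - b.1.2) • τ (t b) ∈ H (t b) := by
  -- The entry of a box is the cycle at which it joins the diagram.
  have h1 : ∀ b : lam.cells, ∃ k : Fin g,
      b.1 ∈ diagram H τ (k + 1) η \ diagram H τ k η := by
    rintro ⟨⟨i, j⟩, hb⟩
    have h := hlam i j hb
    clear hlam hτ
    induction g with
    | zero => simp only [InDiagram] at h; omega
    | succ g ih =>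
      by_cases hg : InDiagram H τ g η i j
      · obtain ⟨k, hk⟩ := ih hg
        exact ⟨k.castSucc, hk⟩
      · exact ⟨Fin.last g, h, hg⟩
  choose t ht using h1
  refine ⟨t, fun b b' hbb => Subtype.ext ?_, fun b => ?_⟩
  · have := diagram_succ_diff_subsingleton hH (hτ (t b) (t b).2)
      (encard_diagram_le (η := η) hH (t b).2.le hτ)
    exact this (ht b) (hbb ▸ ht b')
  · exact ((ht b).1.resolve_left (ht b).2).1

end ChainClass

namespace MetricGraph

/-! ### Piecewise linear functions in one variable -/

lemma eventually_breaks_right {ι : Type*} (s : Finset ι) (m : ι → ℤ) (x : ι → ℝ) (t : ℝ) :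
    ∀ᶠ h in 𝓝[>] (0 : ℝ), ∑ i ∈ s, m i * max 0 (t + h - x i) =
      ∑ i ∈ s, m i * max 0 (t - x i) + ((∑ i ∈ s, if x i ≤ t then m i else 0 : ℤ) : ℝ) * h := by
  have h1 : ∀ i ∈ s, ∀ᶠ h in 𝓝[>] (0 : ℝ),
      m i * max 0 (t + h - x i) =
        m i * max 0 (t - x i) + ((if x i ≤ t then m i else 0 : ℤ) : ℝ) * h := by
    intro i _
    by_cases hi : x i ≤ t
    · filter_upwards [self_mem_nhdsWithin] with h (hh : 0 < h)
      rw [max_eq_right (by linarith), max_eq_right (by linarith), if_pos hi]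
      ring
    · push Not at hi
      filter_upwards [Ioo_mem_nhdsGT (sub_pos.2 hi)] with h hh
      rw [max_eq_left (by linarith [hh.2]), max_eq_left (by linarith), if_neg (by linarith)]
      simp
  filter_upwards [(Filter.eventually_all_finset s).2 h1] with h hh
  rw [Finset.sum_congr rfl hh, Finset.sum_add_distrib]
  push_cast
  rw [Finset.sum_mul]

lemma eventually_breaks_left {ι : Type*} (s : Finset ι) (m : ι → ℤ) (x : ι → ℝ) (t : ℝ) :
    ∀ᶠ h in 𝓝[>] (0 : ℝ), ∑ i ∈ s, m i * max 0 (t - h - x i) =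
      ∑ i ∈ s, m i * max 0 (t - x i) - ((∑ i ∈ s, if x i < t then m i else 0 : ℤ) : ℝ) * h := by
  have h1 : ∀ i ∈ s, ∀ᶠ h in 𝓝[>] (0 : ℝ),
      m i * max 0 (t - h - x i) =
        m i * max 0 (t - x i) - ((if x i < t then m i else 0 : ℤ) : ℝ) * h := by
    intro i _
    by_cases hi : x i < t
    · filter_upwards [Ioo_mem_nhdsGT (sub_pos.2 hi)] with h hh
      rw [max_eq_right (by linarith [hh.2]), max_eq_right (by linarith), if_pos hi]
      ring
    · filter_upwards [self_mem_nhdsWithin] with h (hh : 0 < h)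
      push Not at hi
      rw [max_eq_left (by linarith), max_eq_left (by linarith), if_neg (by linarith)]
      simp
  filter_upwards [(Filter.eventually_all_finset s).2 h1] with h hh
  rw [Finset.sum_congr rfl hh, Finset.sum_sub_distrib]
  push_cast
  rw [Finset.sum_mul]

/-- A piecewise linear function without breaks that starts with value and slope `0` is `0`. -/
lemma eq_zero_of_no_breaks {L : ℝ} {f : ℝ → ℝ} {r l : ℝ → ℝ}
    (hr : ∀ t, 0 ≤ t → t < L → ∀ᶠ h in 𝓝[>] (0 : ℝ), f (t + h) = f t + r t * h)
    (hl : ∀ t, 0 < t → t ≤ L → ∀ᶠ h in 𝓝[>] (0 : ℝ), f (t - h) = f t + l t * h)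
    (hrl : ∀ t, 0 < t → t < L → r t + l t = 0) (f0 : f 0 = 0) (r0 : r 0 = 0) (hL : 0 < L) :
    f L = 0 ∧ l L = 0 := by
  -- vanishing on the left of a point passes to the point and its left slope
  have left : ∀ t, 0 < t → t ≤ L → (∀ x, 0 ≤ x → x < t → f x = 0) → f t = 0 ∧ l t = 0 := by
    intro t h0 h1 hx
    have h2 := (hl t h0 h1).and (Ioo_mem_nhdsGT h0)
    obtain ⟨u, hu, h3⟩ := (mem_nhdsGT_iff_exists_Ioo_subset).1 h2
    have hu : 0 < u := hu
    -- Two sample points on the side where `f` vanishes determine both the value and the slope at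
    -- `t`; continuity is not needed.
    have a := h3 (show u / 2 ∈ Set.Ioo 0 u from ⟨by linarith, by linarith⟩)
    have b := h3 (show u / 3 ∈ Set.Ioo 0 u from ⟨by linarith, by linarith⟩)
    have a1 := a.1
    have b1 := b.1
    rw [hx _ (by linarith [a.2.2]) (by linarith [a.2.1])] at a1
    rw [hx _ (by linarith [b.2.2]) (by linarith [b.2.1])] at b1
    have h4 : l t * u = 0 := by linarith
    have h5 : l t = 0 := (mul_eq_zero.1 h4).resolve_right hu.ne'
    refine ⟨?_, h5⟩
    rw [h5] at a1
    linarith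
  let S : Set ℝ := {t | 0 ≤ t ∧ t ≤ L ∧ ∀ x, 0 ≤ x → x ≤ t → f x = 0}
  have hS0 : (0 : ℝ) ∈ S := ⟨le_rfl, hL.le, fun x h0 h1 => by rw [le_antisymm h1 h0, f0]⟩
  have hSb : BddAbove S := ⟨L, fun t ht => ht.2.1⟩
  set c := sSup S with hc
  have hc0 : 0 ≤ c := le_csSup hSb hS0
  have hcL : c ≤ L := csSup_le ⟨0, hS0⟩ fun t ht => ht.2.1
  have hlt : ∀ x, 0 ≤ x → x < c → f x = 0 := by
    intro x h0 h1
    obtain ⟨t, ht, hxt⟩ := exists_lt_of_lt_csSup ⟨0, hS0⟩ h1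
    exact ht.2.2 x h0 hxt.le
  rcases hcL.lt_or_eq with hlt' | heq
  · exfalso
    have hfr : f c = 0 ∧ r c = 0 := by
      rcases hc0.lt_or_eq with h | h
      · obtain ⟨h1, h2⟩ := left c h hcL hlt
        exact ⟨h1, by linarith [hrl c h hlt']⟩
      · rw [← h]; exact ⟨f0, r0⟩
    have h2 := (hr c hc0 hlt').and (Ioo_mem_nhdsGT (sub_pos.2 hlt'))
    obtain ⟨u, hu, h3⟩ := (mem_nhdsGT_iff_exists_Ioo_subset).1 h2
    have hu : 0 < u := hu
    have hmem : c + u / 2 ∈ S := by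
      have a := h3 (show u / 2 ∈ Set.Ioo 0 u from ⟨by linarith, by linarith⟩)
      refine ⟨by linarith, by linarith [a.2.2], fun x h0 h1 => ?_⟩
      rcases lt_trichotomy x c with h | h | h
      · exact hlt x h0 h
      · rw [h]; exact hfr.1
      · have b := (h3 (show x - c ∈ Set.Ioo 0 u from ⟨by linarith, by linarith⟩)).1
        rw [hfr.1, hfr.2] at b
        simpa using b
    linarith [le_csSup hSb hmem]
  · exact left L hL le_rfl (heq ▸ hlt)

/-- A piecewise linear function is determined by its breaks. -/
lemma value_and_slope_at_end {L : ℝ} {f : ℝ → ℝ} {r l : ℝ → ℤ}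
    (hr : ∀ t, 0 ≤ t → t < L → ∀ᶠ h in 𝓝[>] (0 : ℝ), f (t + h) = f t + r t * h)
    (hl : ∀ t, 0 < t → t ≤ L → ∀ᶠ h in 𝓝[>] (0 : ℝ), f (t - h) = f t + l t * h)
    (hL : 0 < L) (s : Finset ℝ) (m : ℝ → ℤ) (hm0 : ∀ t ∈ s, m t ≠ 0 → 0 < t ∧ t < L)
    (hm : ∀ t, 0 < t → t < L → r t + l t = if t ∈ s then m t else 0) :
    f L = f 0 + r 0 * L + ∑ t ∈ s, m t * (L - t) ∧ l L = -(r 0 + ∑ t ∈ s, m t) := by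
  -- Subtract the explicit function with the same initial value, initial slope and breaks.
  have key := eq_zero_of_no_breaks (L := L)
    (f := fun x => f x - f 0 - r 0 * x - ∑ t ∈ s, m t * max 0 (x - t))
    (r := fun x => r x - r 0 - ((∑ t ∈ s, if t ≤ x then m t else 0 : ℤ) : ℝ))
    (l := fun x => l x + r 0 + ((∑ t ∈ s, if t < x then m t else 0 : ℤ) : ℝ)) ?_ ?_ ?_ ?_ ?_ hL
  · obtain ⟨h1, h2⟩ := key
    constructor
    · have : ∑ t ∈ s, m t * max 0 (L - t) = ∑ t ∈ s, m t * (L - t) := by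
        refine Finset.sum_congr rfl fun t ht => ?_
        by_cases h : m t = 0
        · simp [h]
        · rw [max_eq_right (by linarith [(hm0 t ht h).2])]
      simp only [this] at h1
      linarith
    · have : (∑ t ∈ s, if t < L then m t else 0) = ∑ t ∈ s, m t := by
        refine Finset.sum_congr rfl fun t ht => ?_
        by_cases h : m t = 0
        · simp [h]
        · rw [if_pos (hm0 t ht h).2]
      simp only [this] at h2
      have h3 : l L + r 0 + ∑ t ∈ s, m t = 0 := by exact_mod_cast h2
      omega
  · intro t h0 h1
    filter_upwards [hr t h0 h1, eventually_breaks_right s m id t] with h a b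
    simp only [id] at b
    rw [a, b]
    ring
  · intro t h0 h1
    filter_upwards [hl t h0 h1, eventually_breaks_left s m id t] with h a b
    simp only [id] at b
    rw [a, b]
    ring
  · intro t h0 h1
    have h2 : (∑ u ∈ s, if u ≤ t then m u else 0) - (∑ u ∈ s, if u < t then m u else 0) =
        if t ∈ s then m t else 0 := by
      rw [← Finset.sum_sub_distrib, ← Finset.sum_ite_eq s t m]
      refine Finset.sum_congr rfl fun u _ => ?_
      rcases lt_trichotomy u t with h | h | h
      · rw [if_pos h.le, if_pos h, if_neg h.ne', sub_self]
      · subst h; simp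
      · rw [if_neg h.not_ge, if_neg h.not_gt, if_neg h.ne, sub_self]
    have h3 := hm t h0 h1
    rw [← h2] at h3
    have h4 : ((r t + l t : ℤ) : ℝ) = _ := congrArg Int.cast h3
    push_cast at h4 ⊢
    linarith
  · have : ∑ t ∈ s, m t * max 0 (0 - t) = 0 := by
      refine Finset.sum_eq_zero fun t ht => ?_
      by_cases h : m t = 0
      · simp [h]
      · rw [max_eq_left (by linarith [(hm0 t ht h).1]), mul_zero]
    simpa using this
  · have : (∑ t ∈ s, if t ≤ 0 then m t else 0) = 0 := by
      refine Finset.sum_eq_zero fun t ht => ?_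
      by_cases h : m t = 0
      · simp [h]
      · rw [if_neg (by linarith [(hm0 t ht h).1])]
    simp [this]

/-! ### Principal divisors in terms of breaks -/

variable {G : MetricGraph}

lemma pt_of_nonpos (e : G.E) {t : ℝ} (h : t ≤ 0) : G.pt e t = .vertex (G.src e) := by
  simp [pt, not_lt.2 h]

lemma pt_of_len_le (e : G.E) {t : ℝ} (h : G.len e ≤ t) : G.pt e t = .vertex (G.tgt e) := by
  simp [pt, not_lt.2 h, (G.len_pos e).trans_le h]

lemma pt_of_mem (e : G.E) {t : ℝ} (h0 : 0 < t) (h1 : t < G.len e) :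
    G.pt e t = .interior e t h0 h1 := by
  simp [pt, h0, h1]

/-- The divisor of a function with initial slope `c e` on the edge `e` and with breaks `m e i` at
the points `x e i` of `e`. -/
noncomputable def breakDivisor {ι : Type*} (s : Finset ι) (m : G.E → ι → ℤ) (x : G.E → ι → ℝ)
    (c : G.E → ℤ) : G.Div :=
  ∑ e, (Finsupp.single (.vertex (G.src e)) (c e)
    -- `c e` is the slope before every break, even one at parameter 0, and `c e + ∑ m` the slope
    -- after all of them. Breaks at the ends of an edge are thus allowed and contribute to the
    -- vertices.
    - Finsupp.single (.vertex (G.tgt e)) (c e + ∑ i ∈ s, m e i)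
    + ∑ i ∈ s, Finsupp.single (G.pt e (x e i)) (m e i))

open Classical in
lemma breakDivisor_vertex {ι : Type*} (s : Finset ι) (m : G.E → ι → ℤ) (x : G.E → ι → ℝ)
    (c : G.E → ℤ) (v : G.V) : breakDivisor s m x c (.vertex v) =
      ∑ e, ((if G.src e = v then c e + ∑ i ∈ s, (if x e i ≤ 0 then m e i else 0) else 0) +
        (if G.tgt e = v then -(c e + ∑ i ∈ s, m e i) +
          ∑ i ∈ s, (if G.len e ≤ x e i then m e i else 0) else 0)) := by
  rw [breakDivisor, Finsupp.finsetSum_apply]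
  refine Finset.sum_congr rfl fun e _ => ?_
  have h1 : (∑ i ∈ s, Finsupp.single (G.pt e (x e i)) (m e i)) (.vertex v) =
      (if G.src e = v then ∑ i ∈ s, (if x e i ≤ 0 then m e i else 0) else 0) +
      (if G.tgt e = v then ∑ i ∈ s, (if G.len e ≤ x e i then m e i else 0) else 0) := by
    have hite : ∀ (P : Prop) (f : ι → ℤ), (if P then ∑ i ∈ s, f i else 0) =
        ∑ i ∈ s, if P then f i else 0 := fun P f => by split_ifs <;> simp
    rw [Finsupp.finsetSum_apply, hite, hite, ← Finset.sum_add_distrib]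
    refine Finset.sum_congr rfl fun i _ => ?_
    rw [Finsupp.single_apply]
    have hL := G.len_pos e
    rcases le_or_gt (x e i) 0 with h | h
    · rw [pt_of_nonpos e h, if_neg (show ¬ G.len e ≤ x e i by linarith)]
      simp [h]
    rcases le_or_gt (G.len e) (x e i) with h' | h'
    · rw [pt_of_len_le e h', if_neg (show ¬ x e i ≤ 0 by linarith)]
      simp [h']
    · rw [pt_of_mem e h h', if_neg (show ¬ x e i ≤ 0 by linarith),
        if_neg (show ¬ G.len e ≤ x e i by linarith)]
      simp
  rw [Finsupp.add_apply, Finsupp.sub_apply, h1, Finsupp.single_apply, Finsupp.single_apply]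
  simp only [Point.vertex.injEq]
  split_ifs <;> ring

open Classical in
lemma breakDivisor_interior {ι : Type*} (s : Finset ι) (m : G.E → ι → ℤ) (x : G.E → ι → ℝ)
    (c : G.E → ℤ) (e : G.E) (t : ℝ) (h0 : 0 < t) (h1 : t < G.len e) :
    breakDivisor s m x c (.interior e t h0 h1) = ∑ i ∈ s, (if x e i = t then m e i else 0) := by
  rw [breakDivisor, Finsupp.finsetSum_apply, Finset.sum_eq_single e]
  · rw [Finsupp.add_apply, Finsupp.sub_apply, Finsupp.finsetSum_apply, Finsupp.single_apply,
      Finsupp.single_apply]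
    simp only [reduceCtorEq, if_false, sub_self, zero_add]
    refine Finset.sum_congr rfl fun i _ => ?_
    rw [Finsupp.single_apply]
    congr 1
    rw [← pt_of_mem e h0 h1]
    refine propext ⟨fun h => ?_, fun h => by rw [h]⟩
    rw [pt_of_mem e h0 h1] at h
    unfold pt at h
    split_ifs at h
    simpa using h
  · intro e' _ hne
    rw [Finsupp.add_apply, Finsupp.sub_apply, Finsupp.finsetSum_apply, Finsupp.single_apply,
      Finsupp.single_apply]
    simp only [reduceCtorEq, if_false, sub_self, zero_add]
    refine Finset.sum_eq_zero fun i _ => ?_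
    rw [Finsupp.single_apply, if_neg]
    intro h
    unfold pt at h
    split_ifs at h
    simp only [Point.interior.injEq] at h
    exact hne h.1
  · simp

/-- Prescribed values at the vertices, slopes and breaks that fit together define a rational
function. -/
theorem breakDivisor_mem_principal {ι : Type*} (s : Finset ι) (m : G.E → ι → ℤ)
    (x : G.E → ι → ℝ) (c : G.E → ℤ) (h : G.V → ℝ)
    (hx : ∀ e, ∀ i ∈ s, m e i ≠ 0 → 0 ≤ x e i ∧ x e i ≤ G.len e)
    (hh : ∀ e, h (G.tgt e) = h (G.src e) + c e * G.len e + ∑ i ∈ s, m e i * (G.len e - x e i)) :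
    breakDivisor s m x c ∈ G.principal := by
  classical
  let F : G.E → ℝ → ℝ := fun e t => h (G.src e) + c e * t + ∑ i ∈ s, m e i * max 0 (t - x e i)
  have F0 : ∀ e, F e 0 = h (G.src e) := by
    intro e
    have : ∑ i ∈ s, m e i * max 0 (0 - x e i) = 0 := by
      refine Finset.sum_eq_zero fun i hi => ?_
      by_cases hm : m e i = 0
      · simp [hm]
      · rw [max_eq_left (by linarith [(hx e i hi hm).1]), mul_zero]
    simpa [F] using this
  have FL : ∀ e, F e (G.len e) = h (G.tgt e) := by
    intro e
    rw [hh e]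
    refine congrArg _ (Finset.sum_congr rfl fun i hi => ?_)
    by_cases hm : m e i = 0
    · simp [hm]
    · rw [max_eq_right (by linarith [(hx e i hi hm).2])]
  let toFun : G.Point → ℝ := fun p => match p with
    | .vertex v => h v
    | .interior e t _ _ => F e t
  have hpt : ∀ e t, 0 ≤ t → t ≤ G.len e → toFun (G.pt e t) = F e t := by
    intro e t h0 h1
    rcases h0.lt_or_eq with h0 | rfl
    · rcases h1.lt_or_eq with h1 | rfl
      · rw [pt_of_mem e h0 h1]
      · rw [pt_of_len_le e le_rfl, FL]
    · rw [pt_of_nonpos e le_rfl, F0]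
  refine ⟨⟨toFun, fun e t => c e + ∑ i ∈ s, if x e i ≤ t then m e i else 0,
    fun e t => -(c e) - ∑ i ∈ s, if x e i < t then m e i else 0, ?_, ?_⟩, ?_⟩
  · intro e t h0 h1
    filter_upwards [Ioo_mem_nhdsGT (sub_pos.2 h1), eventually_breaks_right s (m e) (x e) t]
      with u hu h2
    rw [hpt e t h0 h1.le, hpt e (t + u) (by linarith [hu.1]) (by linarith [hu.2])]
    simp only [F]
    rw [h2]
    push_cast; ring
  · intro e t h0 h1
    filter_upwards [Ioo_mem_nhdsGT h0, eventually_breaks_left s (m e) (x e) t]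
      with u hu h2
    rw [hpt e t h0.le h1, hpt e (t - u) (by linarith [hu.2]) (by linarith [hu.1])]
    simp only [F]
    rw [h2]
    push_cast; ring
  · rintro (v | ⟨e, t, h0, h1⟩)
    · rw [breakDivisor_vertex]
      simp only [RationalFunction.ord]
      refine Finset.sum_congr rfl fun e _ => ?_
      congr 2
      have : ∑ i ∈ s, m e i = (∑ i ∈ s, if G.len e ≤ x e i then m e i else 0) +
          ∑ i ∈ s, if x e i < G.len e then m e i else 0 := by
        rw [← Finset.sum_add_distrib]
        refine Finset.sum_congr rfl fun i _ => ?_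
        by_cases hi : G.len e ≤ x e i
        · rw [if_pos hi, if_neg hi.not_gt, add_zero]
        · rw [if_neg hi, if_pos (not_le.1 hi), zero_add]
      rw [this]
      ring
    · rw [breakDivisor_interior]
      simp only [RationalFunction.ord]
      have : ∀ a b c : ℤ, c + a + (-c - b) = a - b := fun _ _ _ => by ring
      rw [this, ← Finset.sum_sub_distrib]
      refine Finset.sum_congr rfl fun i _ => ?_
      rcases lt_trichotomy (x e i) t with h | h | h
      · rw [if_neg h.ne, if_pos h.le, if_pos h, sub_self]
      · simp [h]
      · rw [if_neg h.ne', if_neg h.not_ge, if_neg h.not_gt, sub_self]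

/-- Every principal divisor is given by values at the vertices, slopes and breaks. -/
theorem exists_breakDivisor_of_mem_principal {D : G.Div} (hD : D ∈ G.principal) :
    ∃ (s : Finset ℝ) (m : G.E → ℝ → ℤ) (c : G.E → ℤ) (h : G.V → ℝ),
      (∀ e, ∀ t ∈ s, m e t ≠ 0 → 0 < t ∧ t < G.len e) ∧
      (∀ e, h (G.tgt e) = h (G.src e) + c e * G.len e + ∑ t ∈ s, m e t * (G.len e - t)) ∧
      D = breakDivisor s m (fun _ t => t) c := by
  classical
  obtain ⟨f, hf⟩ := hD
  -- The parameters of the support, pooled over all edges. The value 0 given to vertices is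
  -- harmless, as `m` vanishes outside the open edge.
  let s : Finset ℝ := D.support.image fun p => match p with
    | .vertex _ => 0
    | .interior _ t _ _ => t
  let m : G.E → ℝ → ℤ := fun e t => if 0 < t ∧ t < G.len e then D (G.pt e t) else 0
  have hm0 : ∀ e, ∀ t ∈ s, m e t ≠ 0 → 0 < t ∧ t < G.len e := by
    intro e t _ h
    by_contra hc
    exact h (if_neg hc)
  have hs : ∀ e t, 0 < t → t < G.len e → f.right e t + f.left e t = if t ∈ s then m e t else 0 := by
    intro e t h0 h1
    have h2 : D (G.pt e t) = f.right e t + f.left e t := by rw [hf, pt_of_mem e h0 h1]; rfl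
    simp only [m, h0, h1, and_self, if_true]
    split_ifs with h
    · exact h2.symm
    · by_contra hc
      refine h (Finset.mem_image.2 ⟨G.pt e t, by rw [Finsupp.mem_support_iff, h2]; exact hc, ?_⟩)
      rw [pt_of_mem e h0 h1]
  have hend := fun e => value_and_slope_at_end (L := G.len e) (f := fun t => f.toFun (G.pt e t))
    (f.right_spec e) (f.left_spec e) (G.len_pos e) s (m e) (hm0 e) (hs e)
  refine ⟨s, m, fun e => f.right e 0, fun v => f.toFun (.vertex v), hm0, fun e => ?_, ?_⟩
  · have := (hend e).1
    rwa [pt_of_len_le e le_rfl, pt_of_nonpos e le_rfl] at this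
  · ext p
    rcases p with v | ⟨e, t, h0, h1⟩
    · rw [hf, breakDivisor_vertex]
      simp only [RationalFunction.ord]
      refine Finset.sum_congr rfl fun e _ => ?_
      have a1 : (∑ t ∈ s, if t ≤ 0 then m e t else 0) = 0 := by
        refine Finset.sum_eq_zero fun t ht => ?_
        by_cases h : m e t = 0
        · simp [h]
        · rw [if_neg (by linarith [(hm0 e t ht h).1])]
      have a2 : (∑ t ∈ s, if G.len e ≤ t then m e t else 0) = 0 := by
        refine Finset.sum_eq_zero fun t ht => ?_
        by_cases h : m e t = 0
        · simp [h]
        · rw [if_neg (by linarith [(hm0 e t ht h).2])]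
      rw [a1, a2, (hend e).2, add_zero, add_zero]
    · rw [breakDivisor_interior, Finset.sum_ite_eq' s t, ← hs e t h0 h1, hf]
      rfl

end MetricGraph

namespace MetricGraph

variable {G : MetricGraph}

lemma deg_single (p : G.Point) (a : ℤ) : G.deg (Finsupp.single p a) = a := by
  simp [deg]

lemma deg_breakDivisor {ι : Type*} (s : Finset ι) (m : G.E → ι → ℤ) (x : G.E → ι → ℝ)
    (c : G.E → ℤ) : G.deg (breakDivisor s m x c) = 0 := by
  simp [breakDivisor, deg_single]

lemma deg_eq_sum (D : G.Div) : G.deg D = ∑ p ∈ D.support, D p := by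
  simp [deg, Finsupp.sum]

end MetricGraph

/-! ### Coordinates on the cycles -/

namespace ChainOfCycles

open MetricGraph

variable {n : ℕ} (Γ : ChainOfCycles n)

/-- The length of the `k`th cycle. -/
def circ (k : Fin (n + 1)) : ℝ := Γ.top k + Γ.bot k

lemma circ_pos (k : Fin (n + 1)) : 0 < Γ.circ k := add_pos (Γ.top_pos k) (Γ.bot_pos k)

/-- The vertex `v i` of the metric graph. -/
noncomputable def vtxL (i : Fin (n + 1)) : Γ.toMetricGraph.V := Γ.v i

/-- The vertex `w i` of the metric graph. -/
def vtxR (i : Fin (n + 1)) : Γ.toMetricGraph.V := Γ.w i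

/-- The clockwise edge from `v i` to `w i`. -/
def edgeTop (i : Fin (n + 1)) : Γ.toMetricGraph.E := (Edge.top i : Γ.Edge)

/-- The clockwise edge from `w i` to `v i`. -/
def edgeBot (i : Fin (n + 1)) : Γ.toMetricGraph.E := (Edge.bot i : Γ.Edge)

/-- The bridge from `w j` to `v (j + 1)`. -/
def edgeBridge (j : Fin n) (h : 0 < Γ.bridge j) : Γ.toMetricGraph.E := (Edge.bridge j h : Γ.Edge)

variable {Γ} in
@[elab_as_elim]
lemma edge_cases {P : Γ.toMetricGraph.E → Prop} (e : Γ.toMetricGraph.E)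
    (top : ∀ i, P (Γ.edgeTop i)) (bot : ∀ i, P (Γ.edgeBot i))
    (bridge : ∀ j h, P (Γ.edgeBridge j h)) : P e :=
  match (e : Γ.Edge) with
  | .top i => top i
  | .bot i => bot i
  | .bridge j h => bridge j h

@[simp] lemma src_edgeTop (i) : Γ.toMetricGraph.src (Γ.edgeTop i) = Γ.vtxL i := rfl
@[simp] lemma tgt_edgeTop (i) : Γ.toMetricGraph.tgt (Γ.edgeTop i) = Γ.vtxR i := rfl
@[simp] lemma len_edgeTop (i) : Γ.toMetricGraph.len (Γ.edgeTop i) = Γ.top i := rfl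
@[simp] lemma src_edgeBot (i) : Γ.toMetricGraph.src (Γ.edgeBot i) = Γ.vtxR i := rfl
@[simp] lemma tgt_edgeBot (i) : Γ.toMetricGraph.tgt (Γ.edgeBot i) = Γ.vtxL i := rfl
@[simp] lemma len_edgeBot (i) : Γ.toMetricGraph.len (Γ.edgeBot i) = Γ.bot i := rfl
@[simp] lemma src_edgeBridge (j h) :
    Γ.toMetricGraph.src (Γ.edgeBridge j h) = Γ.vtxR j.castSucc := rfl
@[simp] lemma tgt_edgeBridge (j h) :
    Γ.toMetricGraph.tgt (Γ.edgeBridge j h) = Γ.vtxL j.succ := rfl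
@[simp] lemma len_edgeBridge (j h) :
    Γ.toMetricGraph.len (Γ.edgeBridge j h) = Γ.bridge j := rfl

@[simp] lemma edgeTop_inj {i i'} : Γ.edgeTop i = Γ.edgeTop i' ↔ i = i' :=
  ⟨fun h => Edge.top.inj h, fun h => h ▸ rfl⟩
@[simp] lemma edgeBot_inj {i i'} : Γ.edgeBot i = Γ.edgeBot i' ↔ i = i' :=
  ⟨fun h => Edge.bot.inj h, fun h => h ▸ rfl⟩
@[simp] lemma edgeBridge_inj {j h j' h'} : Γ.edgeBridge j h = Γ.edgeBridge j' h' ↔ j = j' :=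
  ⟨fun h => Edge.bridge.inj h, fun h => by subst h; rfl⟩
@[simp] lemma edgeTop_ne_edgeBot (i i') : Γ.edgeTop i ≠ Γ.edgeBot i' := fun h => by
  unfold edgeTop edgeBot at h; cases h
@[simp] lemma edgeBot_ne_edgeTop (i i') : Γ.edgeBot i ≠ Γ.edgeTop i' := fun h => by
  unfold edgeTop edgeBot at h; cases h
@[simp] lemma edgeBridge_ne_edgeTop (j h i) : Γ.edgeBridge j h ≠ Γ.edgeTop i := fun h => by
  unfold edgeTop edgeBridge at h; cases h
@[simp] lemma edgeBridge_ne_edgeBot (j h i) : Γ.edgeBridge j h ≠ Γ.edgeBot i := fun h => by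
  unfold edgeBot edgeBridge at h; cases h
@[simp] lemma edgeTop_ne_edgeBridge (j h i) : Γ.edgeTop i ≠ Γ.edgeBridge j h :=
  (Γ.edgeBridge_ne_edgeTop j h i).symm
@[simp] lemma edgeBot_ne_edgeBridge (j h i) : Γ.edgeBot i ≠ Γ.edgeBridge j h :=
  (Γ.edgeBridge_ne_edgeBot j h i).symm

lemma v_succ_of_pos {j : Fin n} (h : 0 < Γ.bridge j) : Γ.v j.succ = .left j h := by
  simp [v, h]

lemma v_succ_of_not_pos {j : Fin n} (h : ¬ 0 < Γ.bridge j) : Γ.v j.succ = Γ.w j.castSucc := by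
  simp [v, w, h]

lemma vtxL_succ_of_not_pos {j : Fin n} (h : ¬ 0 < Γ.bridge j) :
    Γ.vtxL j.succ = Γ.vtxR j.castSucc := Γ.v_succ_of_not_pos h

variable {Γ} in
lemma eq_vtxL_or_eq_vtxR (u : Γ.toMetricGraph.V) :
    (∃ i, u = Γ.vtxL i) ∨ ∃ i, u = Γ.vtxR i :=
  match (u : Γ.Vertex) with
  | .start => Or.inl ⟨0, rfl⟩
  | .right i => Or.inr ⟨i, rfl⟩
  | .left j h => Or.inl ⟨j.succ, (Γ.v_succ_of_pos h).symm⟩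

/-- The clockwise coordinate, from `v k`, of the retraction of a vertex to the `k`th cycle. -/
def coordV (k : Fin (n + 1)) (u : Γ.toMetricGraph.V) : ℝ :=
  match (u : Γ.Vertex) with
  | .start => 0
  | .right i => if k ≤ i then Γ.top k else 0
  | .left j _ => if k ≤ j.castSucc then Γ.top k else 0

/-- The clockwise coordinate, from `v k`, of the retraction of a point of an edge to the `k`th
cycle. -/
def coordE (k : Fin (n + 1)) (e : Γ.toMetricGraph.E) (t : ℝ) : ℝ :=
  match (e : Γ.Edge) with
  | .top i => if k < i then Γ.top k else if k = i then t else 0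
  | .bot i => if k < i then Γ.top k else if k = i then Γ.top k + t else 0
  | .bridge j _ => if k ≤ j.castSucc then Γ.top k else 0

/-- The clockwise coordinate, from `v k`, of the retraction of a point to the `k`th cycle. -/
def coord (k : Fin (n + 1)) : Γ.toMetricGraph.Point → ℝ
  | .vertex u => Γ.coordV k u
  | .interior e t _ _ => Γ.coordE k e t

/-- The harmonic form that runs once around the `k`th cycle. -/
def form (k : Fin (n + 1)) (e : Γ.toMetricGraph.E) : ℝ :=
  match (e : Γ.Edge) with
  | .top i => if k = i then 1 else 0
  | .bot i => if k = i then 1 else 0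
  | .bridge _ _ => 0

/-- The indicator function of the vertices on the right of the `j`th bridge. -/
def rightOf (j : Fin n) (u : Γ.toMetricGraph.V) : ℝ :=
  match (u : Γ.Vertex) with
  | .start => 0
  | .right i => if j.succ ≤ i then 1 else 0
  | .left j' _ => if j ≤ j' then 1 else 0

@[simp] lemma coordE_edgeTop (k i t) : Γ.coordE k (Γ.edgeTop i) t =
    if k < i then Γ.top k else if k = i then t else 0 := rfl
@[simp] lemma coordE_edgeBot (k i t) : Γ.coordE k (Γ.edgeBot i) t =
    if k < i then Γ.top k else if k = i then Γ.top k + t else 0 := rfl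
@[simp] lemma coordE_edgeBridge (k j h t) : Γ.coordE k (Γ.edgeBridge j h) t =
    if k ≤ j.castSucc then Γ.top k else 0 := rfl
@[simp] lemma form_edgeTop (k i) : Γ.form k (Γ.edgeTop i) = if k = i then 1 else 0 := rfl
@[simp] lemma form_edgeBot (k i) : Γ.form k (Γ.edgeBot i) = if k = i then 1 else 0 := rfl
@[simp] lemma form_edgeBridge (k j h) : Γ.form k (Γ.edgeBridge j h) = 0 := rfl

@[simp] lemma coordV_vtxR (k i) : Γ.coordV k (Γ.vtxR i) = if k ≤ i then Γ.top k else 0 := rfl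

@[simp] lemma coordV_vtxL (k i) : Γ.coordV k (Γ.vtxL i) = if k < i then Γ.top k else 0 := by
  cases i using Fin.cases with
  | zero => simp; rfl
  | succ j =>
    by_cases h : 0 < Γ.bridge j
    · rw [vtxL, v_succ_of_pos Γ h]
      simp only [← Fin.le_castSucc_iff]
      rfl
    · rw [vtxL_succ_of_not_pos Γ h, coordV_vtxR]
      simp only [Fin.le_castSucc_iff]

@[simp] lemma rightOf_vtxR (j i) : Γ.rightOf j (Γ.vtxR i) = if j.succ ≤ i then 1 else 0 := rfl

-- The bridge must have positive length: otherwise `v (j + 1)` is the point `w j`, which counts as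
-- left.
@[simp] lemma rightOf_vtxL {j : Fin n} (hj : 0 < Γ.bridge j) (i) :
    Γ.rightOf j (Γ.vtxL i) = if j.succ ≤ i then 1 else 0 := by
  cases i using Fin.cases with
  | zero => simp; rfl
  | succ j' =>
    by_cases h : 0 < Γ.bridge j'
    · rw [vtxL, v_succ_of_pos Γ h]
      simp only [Fin.succ_le_succ_iff]
      rfl
    · rw [vtxL_succ_of_not_pos Γ h, rightOf_vtxR]
      have hne : j ≠ j' := by rintro rfl; exact h hj
      have : j.succ ≤ j'.castSucc ↔ j.succ ≤ j'.succ := by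
        rw [Fin.succ_le_succ_iff, Fin.le_def, Fin.le_def]
        have : (j : ℕ) ≠ j' := fun h => hne (Fin.ext h)
        simp only [Fin.val_succ, Fin.val_castSucc]
        omega
      simp only [this]

lemma coordV_src (k : Fin (n + 1)) (e : Γ.toMetricGraph.E) :
    Γ.coordV k (Γ.toMetricGraph.src e) = Γ.coordE k e 0 := by
  induction e using edge_cases with
  | top i => simp
  | bot i =>
    rcases lt_trichotomy k i with h | h | h
    · simp [h, h.le]
    · simp [h]
    · simp [h.not_ge, h.not_gt, h.ne']
  | bridge j h => simp

-- At the end of the bottom edge the coordinate drops from the length of the cycle to 0. This jump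
-- is the only source of periods.
open Classical in
lemma coordV_tgt (k : Fin (n + 1)) (e : Γ.toMetricGraph.E) :
    Γ.coordV k (Γ.toMetricGraph.tgt e) =
      Γ.coordE k e (Γ.toMetricGraph.len e) - if e = Γ.edgeBot k then Γ.circ k else 0 := by
  induction e using edge_cases with
  | top i =>
    rcases lt_trichotomy k i with h | h | h
    · simp [h, h.le]
    · simp [h]
    · simp [h.not_ge, h.not_gt, h.ne']
  | bot i =>
    rcases lt_trichotomy k i with h | h | h
    · simp [h, h.ne']
    · simp [h, circ]
    · simp [h.not_gt, h.ne, h.ne']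
  | bridge j h => simp [Fin.le_castSucc_iff]

lemma coordE_eq (k : Fin (n + 1)) (e : Γ.toMetricGraph.E) (t : ℝ) :
    Γ.coordE k e t = Γ.coordE k e 0 + Γ.form k e * t := by
  induction e using edge_cases with
  | top i =>
    rcases lt_trichotomy k i with h | h | h
    · simp [h, h.ne]
    · simp [h]
    · simp [h.not_gt, h.ne']
  | bot i =>
    rcases lt_trichotomy k i with h | h | h
    · simp [h, h.ne]
    · simp [h]
    · simp [h.not_gt, h.ne']
  | bridge j h => simp

lemma coord_pt (k : Fin (n + 1)) (e : Γ.toMetricGraph.E) {t : ℝ} (h0 : 0 ≤ t)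
    (h1 : t < Γ.toMetricGraph.len e) :
    Γ.coord k (Γ.toMetricGraph.pt e t) = Γ.coordE k e t := by
  rcases h0.lt_or_eq with h0 | rfl
  · rw [pt_of_mem e h0 h1]; rfl
  · rw [pt_of_nonpos e le_rfl]
    exact Γ.coordV_src k e

lemma sum_edges_eq {M : Type*} [AddCommMonoid M] (k : Fin (n + 1)) (F : Γ.toMetricGraph.E → M)
    (hF : ∀ e, e ≠ Γ.edgeTop k → e ≠ Γ.edgeBot k → F e = 0) :
    ∑ e, F e = F (Γ.edgeTop k) + F (Γ.edgeBot k) :=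
  Finset.sum_eq_add _ _ (by simp) (fun e _ he => hF e he.1 he.2) (by simp) (by simp)

lemma form_eq_zero {k : Fin (n + 1)} {e : Γ.toMetricGraph.E} (h1 : e ≠ Γ.edgeTop k)
    (h2 : e ≠ Γ.edgeBot k) : Γ.form k e = 0 := by
  induction e using edge_cases with
  | top i => simpa [eq_comm] using h1
  | bot i => simpa [eq_comm] using h2
  | bridge j h => rfl

/-! ### The Abel-Jacobi map -/

/-- The sum of the coordinates on the `k`th cycle. -/
noncomputable def abelJacobi (k : Fin (n + 1)) : Γ.toMetricGraph.Div →+ ℝ :=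
  Finsupp.liftAddHom fun p => (AddMonoidHom.mulRight (Γ.coord k p)).comp (Int.castAddHom ℝ)

lemma abelJacobi_single (k : Fin (n + 1)) (p : Γ.toMetricGraph.Point) (a : ℤ) :
    Γ.abelJacobi k (Finsupp.single p a) = a * Γ.coord k p := by
  simp [abelJacobi]

lemma abelJacobi_eq_sum (k : Fin (n + 1)) (D : Γ.toMetricGraph.Div) :
    Γ.abelJacobi k D = ∑ p ∈ D.support, D p * Γ.coord k p := by
  simp [abelJacobi, Finsupp.sum]

/-- Summation by parts: the increments of the function along the two edges of the cycle cancel, and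
what remains is the final slope on the bottom edge times the length of the cycle. -/
lemma abelJacobi_mem_of_mem_principal {D : Γ.toMetricGraph.Div} (hD : D ∈ Γ.toMetricGraph.principal)
    (k : Fin (n + 1)) : Γ.abelJacobi k D ∈ AddSubgroup.zmultiples (Γ.circ k) := by
  classical
  obtain ⟨s, m, c, h, hm, hh, rfl⟩ := exists_breakDivisor_of_mem_principal hD
  have key : Γ.abelJacobi k (breakDivisor s m (fun _ t => t) c) =
      ∑ e : Γ.toMetricGraph.E,
        (-(Γ.form k e * (h (Γ.toMetricGraph.tgt e) - h (Γ.toMetricGraph.src e))) +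
        (c e + ∑ t ∈ s, m e t) * (if e = Γ.edgeBot k then Γ.circ k else 0)) := by
    rw [breakDivisor, map_sum]
    refine Finset.sum_congr rfl fun e _ => ?_
    have h1 : ∑ t ∈ s, (m e t : ℝ) * Γ.coord k (Γ.toMetricGraph.pt e t) =
        ∑ t ∈ s, ((m e t : ℝ) * (Γ.coordE k e 0 + Γ.form k e * Γ.toMetricGraph.len e) -
          Γ.form k e * ((m e t : ℝ) * (Γ.toMetricGraph.len e - t))) := by
      refine Finset.sum_congr rfl fun t ht => ?_
      by_cases hz : m e t = 0
      · simp [hz]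
      · obtain ⟨h0, h1⟩ := hm e t ht hz
        rw [coord_pt Γ k e h0.le h1, coordE_eq]
        ring
    have h2 : ∑ t ∈ s, (m e t : ℝ) * (Γ.toMetricGraph.len e - t) =
        h (Γ.toMetricGraph.tgt e) - h (Γ.toMetricGraph.src e) - c e * Γ.toMetricGraph.len e := by
      have := hh e
      linarith
    have h3 : Γ.coord k (.vertex (Γ.toMetricGraph.src e)) = Γ.coordE k e 0 := Γ.coordV_src k e
    have h4 : Γ.coord k (.vertex (Γ.toMetricGraph.tgt e)) = _ := Γ.coordV_tgt k e
    rw [map_add, map_sub, map_sum]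
    simp only [abelJacobi_single]
    rw [h1, Finset.sum_sub_distrib, ← Finset.mul_sum, ← Finset.sum_mul, h2]
    change (c e : ℝ) * Γ.coord k (.vertex (Γ.toMetricGraph.src e)) -
      ((c e + ∑ i ∈ s, m e i : ℤ) : ℝ) * Γ.coord k (.vertex (Γ.toMetricGraph.tgt e)) + _ = _
    rw [h3, h4, coordE_eq Γ k e (Γ.toMetricGraph.len e)]
    push_cast
    ring
  rw [key, sum_edges_eq Γ k]
  · refine AddSubgroup.mem_zmultiples_iff.2 ⟨c (Γ.edgeBot k) + ∑ t ∈ s, m (Γ.edgeBot k) t, ?_⟩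
    simp
    ring
  · intro e h1 h2
    simp [form_eq_zero Γ h1 h2, h2]

/-! ### Principal divisors on a single cycle -/

/-- The point of the `k`th cycle with the coordinate `x`. -/
noncomputable def cyclePt (k : Fin (n + 1)) (x : ℝ) : Γ.toMetricGraph.Point :=
  if x ≤ Γ.top k then Γ.toMetricGraph.pt (Γ.edgeTop k) x
  else Γ.toMetricGraph.pt (Γ.edgeBot k) (x - Γ.top k)

lemma cyclePt_zero (k : Fin (n + 1)) : Γ.cyclePt k 0 = .vertex (Γ.vtxL k) := by
  rw [cyclePt, if_pos (Γ.top_pos k).le, pt_of_nonpos _ le_rfl]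
  rfl

lemma cyclePt_top (k : Fin (n + 1)) : Γ.cyclePt k (Γ.top k) = .vertex (Γ.vtxR k) := by
  rw [cyclePt, if_pos le_rfl]
  exact pt_of_len_le (Γ.edgeTop k) le_rfl

lemma coord_cyclePt (k i : Fin (n + 1)) {x : ℝ} (h0 : 0 ≤ x) (h1 : x < Γ.circ i) :
    Γ.coord k (Γ.cyclePt i x) = if k < i then Γ.top k else if k = i then x else 0 := by
  have hi := Γ.top_pos i
  by_cases h : x ≤ Γ.top i
  · rcases h.lt_or_eq with h | rfl
    · rw [cyclePt, if_pos h.le, coord_pt Γ k (Γ.edgeTop i) h0 h]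
      rfl
    · rw [cyclePt_top]
      refine (Γ.coordV_vtxR k i).trans ?_
      rcases lt_trichotomy k i with h | h | h
      · simp [h, h.le]
      · simp [h]
      · simp [h.not_ge, h.not_gt, h.ne']
  · rw [cyclePt, if_neg h, coord_pt Γ k _ (by linarith)
      (by rw [len_edgeBot]; unfold circ at h1; linarith)]
    rw [coordE_edgeBot]
    by_cases hk : k = i
    · subst hk; simp
    · simp [hk]

lemma coord_mem (k : Fin (n + 1)) (p : Γ.toMetricGraph.Point) :
    0 ≤ Γ.coord k p ∧ Γ.coord k p < Γ.circ k := by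
  have h1 := Γ.top_pos k
  have h2 := Γ.bot_pos k
  have h3 : (0 : ℝ) ≤ 0 ∧ 0 < Γ.circ k := ⟨le_rfl, Γ.circ_pos k⟩
  have h4 : 0 ≤ Γ.top k ∧ Γ.top k < Γ.circ k := ⟨h1.le, by unfold circ; linarith⟩
  rcases p with (_ | i | ⟨j, h⟩) | ⟨i | i | ⟨j, h⟩, t, ht0, ht1⟩
  · exact h3
  · simp only [coord, coordV]; split_ifs; exacts [h4, h3]
  · simp only [coord, coordV]; split_ifs; exacts [h4, h3]
  · simp only [coord, coordE]
    split_ifs with a b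
    · exact h4
    · subst b
      change t < Γ.top k at ht1
      exact ⟨ht0.le, by unfold circ; linarith⟩
    · exact h3
  · simp only [coord, coordE]
    split_ifs with a b
    · exact h4
    · subst b
      change t < Γ.bot k at ht1
      exact ⟨by linarith, by unfold circ; linarith⟩
    · exact h3
  · simp only [coord, coordE]; split_ifs; exacts [h4, h3]

/-- A divisor of degree `0` on a cycle whose coordinates sum to a multiple of the length is
principal. -/
lemma mapDomain_cyclePt_mem_principal {D : Γ.toMetricGraph.Div} (hD : Γ.toMetricGraph.deg D = 0)
    (k : Fin (n + 1)) (hk : Γ.abelJacobi k D ∈ AddSubgroup.zmultiples (Γ.circ k)) :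
    D.mapDomain (fun p => Γ.cyclePt k (Γ.coord k p)) ∈ Γ.toMetricGraph.principal := by
  classical
  obtain ⟨z, hz⟩ := AddSubgroup.mem_zmultiples_iff.1 hk
  set s := D.support
  let b₁ : Γ.toMetricGraph.Point → ℤ := fun p => if Γ.coord k p ≤ Γ.top k then D p else 0
  let b₂ : Γ.toMetricGraph.Point → ℤ := fun p => if Γ.coord k p ≤ Γ.top k then 0 else D p
  have hb : ∀ p, b₁ p + b₂ p = D p := fun p => by simp only [b₁, b₂]; split_ifs <;> simp
  have hsum : ∑ p ∈ s, b₁ p + ∑ p ∈ s, b₂ p = 0 := by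
    rw [← Finset.sum_add_distrib, ← hD, deg_eq_sum]
    exact Finset.sum_congr rfl fun p _ => hb p
  let m : Γ.toMetricGraph.E → Γ.toMetricGraph.Point → ℤ := fun e p =>
    if e = Γ.edgeTop k then b₁ p else if e = Γ.edgeBot k then b₂ p else 0
  let x : Γ.toMetricGraph.E → Γ.toMetricGraph.Point → ℝ := fun e p =>
    if e = Γ.edgeTop k then Γ.coord k p else Γ.coord k p - Γ.top k
  -- The function leaves `v k` with slope `z`, the multiple of the length found in `hz`, and by
  -- degree 0 returns there with the same slope.
  let c : Γ.toMetricGraph.E → ℤ := fun e =>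
    if e = Γ.edgeTop k then z else if e = Γ.edgeBot k then z + ∑ p ∈ s, b₁ p else 0
  let a : ℝ := z * Γ.top k + ∑ p ∈ s, b₁ p * (Γ.top k - Γ.coord k p)
  have htop := Γ.top_pos k
  have hbt : (Γ.edgeBot k) ≠ Γ.edgeTop k := by simp
  -- The increment once around the cycle is `z` times its length minus the Abel-Jacobi sum, so the
  -- function closes up.
  have hclose : a + (z + ∑ p ∈ s, (b₁ p : ℝ)) * Γ.bot k +
      ∑ p ∈ s, b₂ p * (Γ.bot k - (Γ.coord k p - Γ.top k)) = 0 := by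
    have h1 : ∑ p ∈ s, (b₁ p : ℝ) * (Γ.top k - Γ.coord k p) + (∑ p ∈ s, (b₁ p : ℝ)) * Γ.bot k +
        ∑ p ∈ s, (b₂ p : ℝ) * (Γ.bot k - (Γ.coord k p - Γ.top k)) =
        ∑ p ∈ s, (D p : ℝ) * (Γ.circ k - Γ.coord k p) := by
      rw [Finset.sum_mul, ← Finset.sum_add_distrib, ← Finset.sum_add_distrib]
      refine Finset.sum_congr rfl fun p _ => ?_
      rw [← hb p]
      unfold circ
      push_cast; ring
    have h2 : ∑ p ∈ s, (D p : ℝ) * (Γ.circ k - Γ.coord k p) = - Γ.abelJacobi k D := by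
      have h3 : ∑ p ∈ s, (D p : ℝ) = 0 := by
        rw [deg_eq_sum] at hD
        exact_mod_cast hD
      simp only [mul_sub]
      rw [Finset.sum_sub_distrib, ← Finset.sum_mul, h3, abelJacobi_eq_sum]
      ring
    simp only [zsmul_eq_mul] at hz
    simp only [a]
    unfold circ at *
    linarith
  -- At vertices `coordV k` is 0 or `top k`, so the function is 0 to the left of the cycle and `a`
  -- to its right.
  have main := breakDivisor_mem_principal s m x c
    (fun u => a / Γ.top k * Γ.coordV k u) ?_ ?_
  · convert main using 1
    rw [breakDivisor]
    rw [sum_edges_eq Γ k]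
    · have e1 : ∑ p ∈ s, m (Γ.edgeTop k) p = ∑ p ∈ s, b₁ p := by simp [m]
      have e2 : ∑ p ∈ s, m (Γ.edgeBot k) p = ∑ p ∈ s, b₂ p := by simp [m]
      have e3 : c (Γ.edgeTop k) = z := by simp [c]
      have e4 : c (Γ.edgeBot k) = z + ∑ p ∈ s, b₁ p := by simp [c]
      rw [e1, e2, e3, e4,
        show z + ∑ p ∈ s, b₁ p + ∑ p ∈ s, b₂ p = z by rw [add_assoc, hsum, add_zero]]
      have e5 : Finsupp.mapDomain (fun p => Γ.cyclePt k (Γ.coord k p)) D =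
          (∑ p ∈ s, Finsupp.single (Γ.toMetricGraph.pt (Γ.edgeTop k) (x (Γ.edgeTop k) p))
            (m (Γ.edgeTop k) p)) +
          ∑ p ∈ s, Finsupp.single (Γ.toMetricGraph.pt (Γ.edgeBot k) (x (Γ.edgeBot k) p))
            (m (Γ.edgeBot k) p) := by
        rw [← Finset.sum_add_distrib]
        refine Finset.sum_congr rfl fun p _ => ?_
        by_cases hp : Γ.coord k p ≤ Γ.top k
        · simp [m, x, b₁, b₂, hp, cyclePt]
        · simp [m, x, b₁, b₂, hp, cyclePt]
      rw [e5]
      change _ = Finsupp.single (Point.vertex (Γ.vtxL k)) z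
        - Finsupp.single (Point.vertex (Γ.vtxR k)) (z + ∑ p ∈ s, b₁ p) + _ +
        (Finsupp.single (Point.vertex (Γ.vtxR k)) (z + ∑ p ∈ s, b₁ p)
        - Finsupp.single (Point.vertex (Γ.vtxL k)) z + _)
      abel
    · intro e h1 h2
      simp [c, m, h1, h2]
  · intro e p _ hm
    have hc := Γ.coord_mem k p
    by_cases h1 : e = Γ.edgeTop k
    · subst h1
      simp only [m, b₁, if_true] at hm
      simp only [x, if_true]
      refine ⟨hc.1, ?_⟩
      by_contra hcon
      exact hm (if_neg hcon)
    by_cases h2 : e = Γ.edgeBot k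
    · subst h2
      simp only [m, b₂, hbt, if_true, if_false] at hm
      simp only [x, hbt, if_false]
      have h3 : ¬ Γ.coord k p ≤ Γ.top k := fun hcon => hm (if_pos hcon)
      refine ⟨by linarith, ?_⟩
      change _ ≤ Γ.bot k
      have := hc.2
      unfold circ at this
      linarith
    · simp [m, h1, h2] at hm
  · intro e
    change a / Γ.top k * Γ.coordV k (Γ.toMetricGraph.tgt e) =
      a / Γ.top k * Γ.coordV k (Γ.toMetricGraph.src e) +
      c e * Γ.toMetricGraph.len e + ∑ p ∈ s, m e p * (Γ.toMetricGraph.len e - x e p)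
    by_cases h1 : e = Γ.edgeTop k
    · subst h1
      simp only [m, x, c, if_true, src_edgeTop, tgt_edgeTop, len_edgeTop, coordV_vtxL, coordV_vtxR,
        le_refl, lt_irrefl, if_false]
      rw [div_mul_cancel₀ _ htop.ne']
      simp only [a]
      ring
    by_cases h2 : e = Γ.edgeBot k
    · subst h2
      simp only [m, x, c, hbt, if_true, src_edgeBot, tgt_edgeBot, len_edgeBot, coordV_vtxL,
        coordV_vtxR, le_refl, lt_irrefl, if_false]
      rw [div_mul_cancel₀ _ htop.ne']
      push_cast
      linarith
    · rw [coordV_src, coordV_tgt, coordE_eq, form_eq_zero Γ h1 h2]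
      simp [c, m, h1, h2]


end ChainOfCycles

/-! ### Reduction of divisors to the cycles -/

namespace ChainOfCycles

open MetricGraph

variable {n : ℕ} (Γ : ChainOfCycles n)

/-- The function is 0 left of the bridge, rises with slope 1 up to parameter `t`, and stays equal to
`t` from there on. -/
lemma single_sub_single_mem_principal_of_bridge {j : Fin n} (hj : 0 < Γ.bridge j) {t : ℝ}
    (h0 : 0 ≤ t) (h1 : t ≤ Γ.bridge j) :
    (Finsupp.single (Γ.toMetricGraph.pt (Γ.edgeBridge j hj) t) 1 -
      Finsupp.single (.vertex (Γ.vtxR j.castSucc)) 1 : Γ.toMetricGraph.Div) ∈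
      Γ.toMetricGraph.principal := by
  classical
  have main := breakDivisor_mem_principal (G := Γ.toMetricGraph) {()}
    (fun e _ => if e = Γ.edgeBridge j hj then -1 else 0) (fun _ _ => t)
    (fun e => if e = Γ.edgeBridge j hj then 1 else 0) (fun u => t * Γ.rightOf j u) ?_ ?_
  · have e1 : breakDivisor (G := Γ.toMetricGraph) {()}
        (fun e _ => if e = Γ.edgeBridge j hj then -1 else 0) (fun _ _ => t)
        (fun e => if e = Γ.edgeBridge j hj then 1 else 0) =
        Finsupp.single (.vertex (Γ.vtxR j.castSucc)) 1 -
          Finsupp.single (Γ.toMetricGraph.pt (Γ.edgeBridge j hj) t) 1 := by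
      rw [breakDivisor, Finset.sum_eq_single (Γ.edgeBridge j hj)]
      · simp [sub_eq_add_neg]
      · intro e _ he
        simp [he]
      · simp
    rw [e1] at main
    simpa using neg_mem main
  · intro e _ _ he
    by_cases h : e = Γ.edgeBridge j hj
    · subst h; exact ⟨h0, h1⟩
    · simp [h] at he
  · intro e
    induction e using edge_cases with
    | top i => simp [rightOf_vtxL Γ hj]
    | bot i => simp [rightOf_vtxL Γ hj]
    | bridge j' h' =>
      by_cases h : j' = j
      · subst h
        simp [rightOf_vtxL Γ hj]
      · have h2 : j.succ ≤ j'.castSucc ↔ j ≤ j' := by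
          have : (j' : ℕ) ≠ j := fun h3 => h (Fin.ext h3)
          rw [Fin.le_def, Fin.le_def]
          simp only [Fin.val_succ, Fin.val_castSucc]
          omega
        simp [rightOf_vtxL Γ hj, h, h2]

/-- The sum telescopes because `v (j + 1)` is equivalent to `w j`, across the bridge or by equality.
-/
lemma vtxL_sub_start_mem_principal (i : Fin (n + 1)) :
    (Finsupp.single (.vertex (Γ.vtxL i)) 1 - Finsupp.single (.vertex (Γ.vtxL 0)) 1 -
      ∑ k, (if k < i then Finsupp.single (.vertex (Γ.vtxR k)) 1 -
        Finsupp.single (.vertex (Γ.vtxL k)) 1 else 0) : Γ.toMetricGraph.Div) ∈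
      Γ.toMetricGraph.principal := by
  induction i using Fin.induction with
  | zero => simp
  | succ j ih =>
    have h1 : (Finsupp.single (.vertex (Γ.vtxL j.succ)) 1 -
        Finsupp.single (.vertex (Γ.vtxR j.castSucc)) 1 : Γ.toMetricGraph.Div) ∈
        Γ.toMetricGraph.principal := by
      by_cases h : 0 < Γ.bridge j
      · have := Γ.single_sub_single_mem_principal_of_bridge h h.le le_rfl
        rwa [pt_of_len_le (Γ.edgeBridge j h) (t := Γ.bridge j) (by simp)] at this
      · rw [vtxL_succ_of_not_pos Γ h, sub_self]
        exact zero_mem _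
    have h2 : ∀ f : Fin (n + 1) → Γ.toMetricGraph.Div, (∑ k, if k < j.succ then f k else 0) =
        (∑ k, if k < j.castSucc then f k else 0) + f j.castSucc := by
      intro f
      rw [← Finset.sum_filter, ← Finset.sum_filter, add_comm (Finset.sum _ _)]
      rw [← Finset.sum_insert (f := f) (by simp)]
      refine Finset.sum_congr ?_ fun _ _ => rfl
      ext k
      simp [← Fin.le_castSucc_iff, le_iff_eq_or_lt]
    rw [h2]
    convert add_mem ih h1 using 1
    abel

/-- Every point lies on some cycle, up to linear equivalence. -/
lemma exists_index (p : Γ.toMetricGraph.Point) : ∃ i : Fin (n + 1),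
    (∀ k < i, Γ.coord k p = Γ.top k) ∧ (∀ k, i < k → Γ.coord k p = 0) ∧
    (Finsupp.single p 1 - Finsupp.single (Γ.cyclePt i (Γ.coord i p)) 1 : Γ.toMetricGraph.Div) ∈
      Γ.toMetricGraph.principal := by
  have hL : ∀ i, Γ.coord i (.vertex (Γ.vtxL i)) = 0 := fun i => by
    rw [coord, coordV_vtxL, if_neg (lt_irrefl i)]
  have hR : ∀ i, Γ.coord i (.vertex (Γ.vtxR i)) = Γ.top i := fun i => by
    rw [coord, coordV_vtxR, if_pos le_rfl]
  rcases p with u | ⟨e, t, h0, h1⟩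
  · rcases eq_vtxL_or_eq_vtxR u with ⟨i, rfl⟩ | ⟨i, rfl⟩
    · refine ⟨i, fun k hk => ?_, fun k hk => ?_, ?_⟩
      · simp [coord, hk]
      · simp [coord, hk.not_gt]
      · rw [hL, cyclePt_zero, sub_self]
        exact zero_mem _
    · refine ⟨i, fun k hk => ?_, fun k hk => ?_, ?_⟩
      · simp [coord, hk.le]
      · simp [coord, hk.not_ge]
      · rw [hR, cyclePt_top, sub_self]
        exact zero_mem _
  · induction e using edge_cases with
    | top i =>
      refine ⟨i, fun k hk => ?_, fun k hk => ?_, ?_⟩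
      · simp [coord, hk]
      · simp [coord, hk.not_gt, hk.ne']
      · have : Γ.cyclePt i t = .interior (Γ.edgeTop i) t h0 h1 := by
          rw [cyclePt, if_pos (by exact h1.le), pt_of_mem _ h0 h1]
        simp only [coord, coordE_edgeTop, lt_irrefl, if_false, if_true]
        rw [this, sub_self]
        exact zero_mem _
    | bot i =>
      refine ⟨i, fun k hk => ?_, fun k hk => ?_, ?_⟩
      · simp [coord, hk]
      · simp [coord, hk.not_gt, hk.ne']
      · have : Γ.cyclePt i (Γ.top i + t) = .interior (Γ.edgeBot i) t h0 h1 := by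
          rw [cyclePt, if_neg (by linarith), add_sub_cancel_left, pt_of_mem _ h0 h1]
        simp only [coord, coordE_edgeBot, lt_irrefl, if_false, if_true]
        rw [this, sub_self]
        exact zero_mem _
    | bridge j h =>
      refine ⟨j.castSucc, fun k hk => ?_, fun k hk => ?_, ?_⟩
      · simp [coord, hk.le]
      · simp [coord, hk.not_ge]
      · simp only [coord, coordE_edgeBridge, le_refl, if_true]
        rw [cyclePt_top, ← pt_of_mem _ h0 h1]
        exact Γ.single_sub_single_mem_principal_of_bridge h h0.le (by exact h1.le)

/-- For a point of cycle `i` the terms with `k > i` vanish, and those with `k < i` are the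
differences `w k - v k`, which telescope from `v 0` to `v i`. -/
lemma single_decomposition (p : Γ.toMetricGraph.Point) :
    (Finsupp.single p 1 - Finsupp.single (.vertex (Γ.vtxL 0)) 1 -
      ∑ k, (Finsupp.single (Γ.cyclePt k (Γ.coord k p)) 1 -
        Finsupp.single (.vertex (Γ.vtxL k)) 1) : Γ.toMetricGraph.Div) ∈
      Γ.toMetricGraph.principal := by
  obtain ⟨i, hl, hr, hi⟩ := Γ.exists_index p
  have h1 : ∑ k, (Finsupp.single (Γ.cyclePt k (Γ.coord k p)) 1 -
        Finsupp.single (.vertex (Γ.vtxL k)) 1 : Γ.toMetricGraph.Div) =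
      ∑ k, (if k < i then Finsupp.single (.vertex (Γ.vtxR k)) 1 -
        Finsupp.single (.vertex (Γ.vtxL k)) 1 else 0) +
      (Finsupp.single (Γ.cyclePt i (Γ.coord i p)) 1 - Finsupp.single (.vertex (Γ.vtxL i)) 1) := by
    rw [← sub_eq_iff_eq_add', ← Finset.sum_sub_distrib, Finset.sum_eq_single i]
    · simp
    · intro k _ hk
      rcases lt_or_gt_of_ne hk with h | h
      · rw [hl k h, cyclePt_top, if_pos h, sub_self]
      · rw [hr k h, cyclePt_zero, if_neg h.not_gt, sub_self, sub_self]
    · simp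
  rw [h1]
  convert add_mem hi (Γ.vtxL_sub_start_mem_principal i) using 1
  abel

lemma decomposition (D : Γ.toMetricGraph.Div) :
    (D - Γ.toMetricGraph.deg D • Finsupp.single (.vertex (Γ.vtxL 0)) 1 -
      ∑ k, (D.mapDomain (fun p => Γ.cyclePt k (Γ.coord k p)) -
        Γ.toMetricGraph.deg D • Finsupp.single (.vertex (Γ.vtxL k)) 1) : Γ.toMetricGraph.Div) ∈
      Γ.toMetricGraph.principal := by
  induction D using Finsupp.induction_linear with
  | zero => simp
  | add D D' h h' =>
    convert add_mem h h' using 1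
    simp only [map_add, Finsupp.mapDomain_add, add_smul, Finset.sum_sub_distrib,
      Finset.sum_add_distrib]
    abel
  | single p a =>
    convert zsmul_mem (Γ.single_decomposition p) a using 1
    simp only [deg_single, Finsupp.mapDomain_single, zsmul_sub, Finset.smul_sum,
      Finsupp.smul_single, smul_eq_mul, mul_one]

/-- The Abel-Jacobi theorem for a chain of cycles. -/
theorem mem_principal_iff {D : Γ.toMetricGraph.Div} : D ∈ Γ.toMetricGraph.principal ↔
    Γ.toMetricGraph.deg D = 0 ∧
      ∀ k, Γ.abelJacobi k D ∈ AddSubgroup.zmultiples (Γ.circ k) := by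
  constructor
  · intro h
    refine ⟨?_, Γ.abelJacobi_mem_of_mem_principal h⟩
    obtain ⟨s, m, c, h, -, -, rfl⟩ := exists_breakDivisor_of_mem_principal h
    exact deg_breakDivisor _ _ _ _
  · rintro ⟨h0, h⟩
    have h1 := Γ.decomposition D
    rw [h0] at h1
    simp only [zero_smul, sub_zero] at h1
    have h2 := sum_mem (S := Γ.toMetricGraph.principal) (t := Finset.univ) fun k _ =>
      Γ.mapDomain_cyclePt_mem_principal h0 k (h k)
    simpa using add_mem h1 h2

/-! ### Ranks -/

/-- The period lattices, indexed by natural numbers. -/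
def periods (k : ℕ) : AddSubgroup ℝ := AddSubgroup.zmultiples (Γ.circ (Fin.ofNat (n + 1) k))

/-- The lengths of the clockwise edges, indexed by natural numbers. -/
def tops (k : ℕ) : ℝ := Γ.top (Fin.ofNat (n + 1) k)

/-- Coordinates on the cycles, indexed by natural numbers. -/
def extend (a : Fin (n + 1) → ℝ) (k : ℕ) : ℝ := a (Fin.ofNat (n + 1) k)

lemma periods_val (k : Fin (n + 1)) : Γ.periods k = AddSubgroup.zmultiples (Γ.circ k) := by
  rw [periods, Fin.ofNat_val_eq_self]

lemma tops_val (k : Fin (n + 1)) : Γ.tops k = Γ.top k := by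
  rw [tops, Fin.ofNat_val_eq_self]

lemma extend_val (a : Fin (n + 1) → ℝ) (k : Fin (n + 1)) : extend a k = a k := by
  rw [extend, Fin.ofNat_val_eq_self]

/-- As `v k ≠ w k`, the length `top k` lies strictly between 0 and the length of the cycle. -/
lemma mem_zmultiples_top {c : ℤ} {k : Fin (n + 1)}
    (h : c • Γ.top k ∈ AddSubgroup.zmultiples (Γ.circ k)) : |c| ≠ 1 := by
  intro hc
  have h1 : Γ.top k ∈ AddSubgroup.zmultiples (Γ.circ k) := by
    rcases eq_or_eq_neg_of_abs_eq hc with rfl | rfl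
    · simpa using h
    · simpa using h
  obtain ⟨z, hz⟩ := AddSubgroup.mem_zmultiples_iff.1 h1
  have h2 := Γ.top_pos k
  have h3 := Γ.bot_pos k
  rw [zsmul_eq_mul, circ] at hz
  have h4 : 0 < z := by
    by_contra! hc
    have : (z : ℝ) ≤ 0 := by exact_mod_cast hc
    nlinarith
  have h5 : (1 : ℝ) ≤ z := by exact_mod_cast h4
  nlinarith

lemma periods_ne_top (k : ℕ) : Γ.periods k ≠ ⊤ := by
  intro h
  have : (1 : ℤ) • Γ.top (Fin.ofNat (n + 1) k) ∈ Γ.periods k := by rw [h]; trivial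
  exact Γ.mem_zmultiples_top this (by simp)

open ChainClass

lemma isEffective_of_divisor {A : Γ.toMetricGraph.Div} (hA : 0 ≤ A) :
    IsEffective Γ.periods Γ.tops (n + 1) (Γ.toMetricGraph.deg A)
      (extend fun k => Γ.abelJacobi k A - Γ.toMetricGraph.deg A * Γ.top k) := by
  have hpt : ∀ p : Γ.toMetricGraph.Point, IsEffective Γ.periods Γ.tops (n + 1) 1
      (extend fun k => Γ.coord k p - Γ.top k) := by
    intro p
    obtain ⟨i, hl, hr, -⟩ := Γ.exists_index p
    -- The chip is counted on cycle `i`. On earlier cycles the degree so far is 0 and the point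
    -- retracts to `w k`; on later ones the degree is 1 and it retracts to `v k`.
    suffices h : ∀ m ≤ n + 1, IsEffective Γ.periods Γ.tops m (if m ≤ i then 0 else 1)
        (extend fun k => Γ.coord k p - Γ.top k) by
      have := h (n + 1) le_rfl
      rwa [if_neg (by have := i.2; omega)] at this
    intro m
    induction m with
    | zero => intro _; simp [IsEffective]
    | succ m ih =>
      intro hm
      have ih := ih (by omega)
      obtain ⟨k, hk⟩ : ∃ k : Fin (n + 1), (k : ℕ) = m := ⟨⟨m, hm⟩, rfl⟩
      rcases lt_trichotomy m (i : ℕ) with h | h | h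
      · rw [if_pos h.le] at ih
        rw [if_pos (by omega)]
        refine ⟨0, by simpa using ih, fun _ => ?_⟩
        rw [← hk, extend_val, hl k (by rw [Fin.lt_def]; omega)]
        simp
      · rw [if_pos h.le] at ih
        rw [if_neg (by omega)]
        exact ⟨1, by simpa using ih, by simp⟩
      · rw [if_neg (by omega)] at ih
        rw [if_neg (by omega)]
        refine ⟨0, by simpa using ih, fun _ => ?_⟩
        rw [← hk, extend_val, hr k (by rw [Fin.lt_def]; omega), tops_val]
        simp
  have hnat : ∀ (p : Γ.toMetricGraph.Point) (a : ℕ), IsEffective Γ.periods Γ.tops (n + 1) a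
      (extend fun k => a * (Γ.coord k p - Γ.top k)) := by
    intro p a
    induction a with
    | zero =>
      convert isEffective_zero (n + 1) using 1
      · simp
      · ext k
        simp [extend]
    | succ a ih =>
      convert ih.add (hpt p) using 1
      · push_cast; ring
      · ext k
        simp only [extend, Pi.add_apply]
        push_cast; ring
  induction A using Finsupp.induction with
  | zero =>
    convert isEffective_zero (n + 1) using 1
    · simp
    · ext k
      simp [extend]
  | single_add p a A hp ha ih =>
    have h1 : 0 ≤ a := by
      have := hA p
      simpa [Finsupp.notMem_support_iff.1 hp] using this
    have h2 : 0 ≤ A := by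
      intro q
      by_cases hq : q = p
      · subst hq; simp [Finsupp.notMem_support_iff.1 hp]
      · have := hA q
        simpa [Finsupp.single_apply, Ne.symm hq] using this
    obtain ⟨a, rfl⟩ := Int.eq_ofNat_of_zero_le h1
    convert (hnat p a).add (ih h2) using 1
    · simp [deg_single]
    · ext k
      simp only [extend, Pi.add_apply, map_add, abelJacobi_single, deg_single]
      push_cast; ring

lemma exists_divisor_of_isEffective {e : ℤ} {η : ℕ → ℝ}
    (h : IsEffective Γ.periods Γ.tops (n + 1) e η) :
    ∃ B : Γ.toMetricGraph.Div, 0 ≤ B ∧ Γ.toMetricGraph.deg B = e ∧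
      ∀ k : Fin (n + 1), η k - (Γ.abelJacobi k B - e * Γ.top k) ∈
        AddSubgroup.zmultiples (Γ.circ k) := by
  -- The last clause holds because the chips placed so far lie left of cycle `m`; chips added there
  -- can then set its coordinate freely.
  suffices H : ∀ m ≤ n + 1, ∀ e, IsEffective Γ.periods Γ.tops m e η →
      ∃ B : Γ.toMetricGraph.Div, 0 ≤ B ∧ Γ.toMetricGraph.deg B = e ∧
      (∀ k : Fin (n + 1), (k : ℕ) < m → η k - (Γ.abelJacobi k B - e * Γ.top k) ∈
        AddSubgroup.zmultiples (Γ.circ k)) ∧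
      (∀ k : Fin (n + 1), m ≤ k → Γ.abelJacobi k B = 0) by
    obtain ⟨B, h1, h2, h3, -⟩ := H (n + 1) le_rfl e h
    exact ⟨B, h1, h2, fun k => h3 k k.2⟩
  intro m
  induction m with
  | zero =>
    intro _ e he
    refine ⟨Finsupp.single (.vertex (Γ.vtxL 0)) e, ?_, deg_single _ _, by simp, fun k _ => ?_⟩
    · exact Finsupp.single_nonneg.2 he
    · rw [abelJacobi_single, coord, coordV_vtxL, if_neg (Fin.not_lt_zero k), mul_zero]
  | succ m ih =>
    rintro hm e ⟨b, hb1, hb2⟩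
    obtain ⟨B, h1, h2, h3, h4⟩ := ih (by omega) _ hb1
    obtain ⟨i, rfl⟩ : ∃ k : Fin (n + 1), (k : ℕ) = m := ⟨⟨m, hm⟩, rfl⟩
    cases b with
    | zero =>
      simp only [Nat.cast_zero, sub_zero] at h2 h3
      refine ⟨B, h1, h2, fun k hk => ?_, fun k hk => h4 k (by omega)⟩
      rcases Nat.lt_succ_iff_lt_or_eq.1 hk with hk | hk
      · exact h3 k hk
      · have hk := Fin.ext hk
        subst hk
        rw [h4 k le_rfl]
        have := hb2 rfl
        rw [periods_val, tops_val, zsmul_eq_mul] at this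
        convert this using 1
        ring
    | succ b =>
      obtain ⟨x, hx, z, hz⟩ : ∃ x ∈ Set.Ico 0 (Γ.circ i), ∃ z : ℤ,
          η i + e * Γ.top i - x = z • Γ.circ i := by
        have hc := Γ.circ_pos i
        refine ⟨toIcoMod hc 0 (η i + e * Γ.top i), ?_, toIcoDiv hc 0 (η i + e * Γ.top i), ?_⟩
        · simpa using toIcoMod_mem_Ico hc 0 (η i + e * Γ.top i)
        · rw [self_sub_toIcoMod]
      have hcyc := fun k => Γ.coord_cyclePt k i hx.1 hx.2
      -- The `b` chips at `v i` have coordinate 0 on cycle `i`, so the remaining chip carries the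
      -- whole coordinate. On earlier cycles each new chip contributes `top k`, which the
      -- normalisation cancels.
      refine ⟨B + Finsupp.single (.vertex (Γ.vtxL i)) (b : ℤ) + Finsupp.single (Γ.cyclePt i x) 1,
        ?_, ?_, ?_, ?_⟩
      · exact add_nonneg (add_nonneg h1 (Finsupp.single_nonneg.2 (by simp)))
          (Finsupp.single_nonneg.2 (by simp))
      · simp only [map_add, deg_single, h2]
        push_cast; ring
      · intro k hk
        simp only [map_add, abelJacobi_single, hcyc k]
        rcases Nat.lt_succ_iff_lt_or_eq.1 hk with hk | hk
        · have := h3 k hk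
          have hk : k < i := hk
          simp only [coord, coordV_vtxL, hk, if_true]
          convert this using 1
          push_cast; ring
        · have hk := Fin.ext hk
          subst hk
          rw [h4 k le_rfl]
          refine AddSubgroup.mem_zmultiples_iff.2 ⟨z, ?_⟩
          rw [← hz]
          simp [coord]
          ring
      · intro k hk
        have h5 := h4 k (by omega)
        have hk : i < k := by rw [Fin.lt_def]; omega
        have hL : Γ.coord k (.vertex (Γ.vtxL i)) = 0 := by simp [coord, hk.not_gt]
        simp [abelJacobi_single, hcyc, hk.not_gt, hk.ne', h5, hL]

lemma coord_markedPoint (k : Fin (n + 1)) : Γ.coord k Γ.markedPoint = Γ.top k := by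
  refine (Γ.coordV_vtxR k (Fin.last n)).trans (if_pos (Fin.le_last k))

/-- The marked point has coordinate `top k` on every cycle, so adding `d` copies of it changes the
degree but not the normalised coordinates. -/
theorem rankAtLeast_iff (D : Γ.toMetricGraph.Div) (hD : Γ.toMetricGraph.deg D = 0) (d : ℤ)
    (r : ℕ) : RankAtLeast (D + Finsupp.single Γ.markedPoint d) r ↔
      RankGE Γ.periods Γ.tops (n + 1) d (extend fun k => Γ.abelJacobi k D) r := by
  constructor
  · intro h ζ hζ
    obtain ⟨A, hA0, hA, hAζ⟩ := Γ.exists_divisor_of_isEffective hζ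
    obtain ⟨B, hB0, hB⟩ := h A hA0 hA
    obtain ⟨hdeg, hB⟩ := Γ.mem_principal_iff.1 hB
    have hBdeg : Γ.toMetricGraph.deg B = d - r := by
      simp only [map_sub, map_add, deg_single, hA, hD] at hdeg
      omega
    have := Γ.isEffective_of_divisor hB0
    rw [hBdeg] at this
    refine this.congr fun k hk => ?_
    obtain ⟨k, rfl⟩ : ∃ i : Fin (n + 1), (i : ℕ) = k := ⟨⟨k, hk⟩, rfl⟩
    rw [Pi.sub_apply, extend_val, extend_val, periods_val]
    convert sub_mem (hB k) (hAζ k) using 1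
    simp only [map_sub, map_add, abelJacobi_single, coord_markedPoint]
    push_cast; ring
  · intro h A hA0 hA
    have hζ := Γ.isEffective_of_divisor hA0
    rw [hA] at hζ
    obtain ⟨B, hB0, hB, hBη⟩ := Γ.exists_divisor_of_isEffective (h _ hζ)
    refine ⟨B, hB0, Γ.mem_principal_iff.2 ⟨?_, fun k => ?_⟩⟩
    · simp only [map_sub, map_add, deg_single, hA, hD, hB]
      ring
    · convert hBη k using 1
      rw [Pi.sub_apply, extend_val, extend_val]
      simp only [map_sub, map_add, abelJacobi_single, coord_markedPoint]
      push_cast; ring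

end ChainOfCycles

/-! ### Pairing with harmonic forms, and dimensions of affine subspaces -/

namespace MetricGraph

variable {G : MetricGraph}

/-- A harmonic form pairs to zero with the differential of a function. -/
lemma sum_harmonic_mul_sub (ω : G.harmonicForms) (u : G.V → ℝ) :
    ∑ e, (ω : G.E → ℝ) e * (u (G.tgt e) - u (G.src e)) = 0 := by
  classical
  have := Fintype.ofFinite G.V
  have key : ∀ f : G.E → G.V, ∑ e, (ω : G.E → ℝ) e * u (f e) =
      ∑ v, u v * ∑ e, (if f e = v then (ω : G.E → ℝ) e else 0) := by
    intro f
    simp only [Finset.mul_sum, mul_ite, mul_zero]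
    rw [Finset.sum_comm]
    refine Finset.sum_congr rfl fun e _ => ?_
    rw [Finset.sum_ite_eq]
    simp [mul_comm]
  simp only [mul_sub]
  rw [Finset.sum_sub_distrib, key, key, sub_eq_zero]
  refine Finset.sum_congr rfl fun v _ => ?_
  congr 1
  convert ω.2 v

lemma deg_chainBoundary (c : G.Segment →₀ ℤ) : G.deg (chainBoundary c) = 0 := by
  rw [chainBoundary, Finsupp.sum, map_sum]
  refine Finset.sum_eq_zero fun s _ => ?_
  rw [map_zsmul, map_sub, deg_single, deg_single, sub_self, smul_zero]

end MetricGraph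

/-- The dimension of an affine coordinate subspace. -/
lemma dimH_setOf_eq {ι : Type*} [Fintype ι] [DecidableEq ι] (K : Finset ι) (c : ι → ℝ) :
    dimH {a : ι → ℝ | ∀ k ∈ K, a k = c k} = ((Fintype.card ι - K.card : ℕ) : ENNReal) := by
  -- For the sup metric, filling in fixed coordinates is an isometry.
  let f : ({k // k ∉ K} → ℝ) → ι → ℝ := fun b k => if h : k ∉ K then b ⟨k, h⟩ else c k
  have hf : Isometry f := by
    intro b b'
    rw [edist_pi_def, edist_pi_def]
    refine le_antisymm (Finset.sup_le fun k _ => ?_) (Finset.sup_le fun k _ => ?_)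
    · by_cases h : k ∈ K
      · simp [f, h]
      · simp only [f, h, not_false_eq_true, dite_true]
        exact Finset.le_sup (f := fun k => edist (b k) (b' k))
          (Finset.mem_univ (⟨k, h⟩ : {k // k ∉ K}))
    · refine le_trans ?_ (Finset.le_sup (f := fun k => edist (f b k) (f b' k))
        (Finset.mem_univ k.1))
      simp [f, k.2]
  have himg : {a : ι → ℝ | ∀ k ∈ K, a k = c k} = f '' Set.univ := by
    ext a
    simp only [Set.mem_ofPred_eq, Set.image_univ, Set.mem_range]
    constructor
    · intro ha
      refine ⟨fun k => a k, ?_⟩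
      ext k
      by_cases h : k ∈ K
      · simp [f, h, ha k h]
      · simp [f, h]
    · rintro ⟨b, rfl⟩ k hk
      simp [f, hk]
  rw [himg, hf.dimH_image, Real.dimH_univ_pi, Fintype.card_subtype_compl, Fintype.card_coe]

namespace ChainOfCycles

open MetricGraph ChainClass

variable {n : ℕ} (Γ : ChainOfCycles n)

lemma genus_toMetricGraph : Γ.toMetricGraph.genus = n + 1 := by
  let P := {j : Fin n // 0 < Γ.bridge j}
  have hE : Nat.card Γ.Edge = (n + 1) + (n + 1) + Nat.card P := by
    rw [Nat.card_congr (β := (Fin (n + 1) ⊕ Fin (n + 1)) ⊕ P)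
      { toFun := fun e => match e with
          | .top i => .inl (.inl i)
          | .bot i => .inl (.inr i)
          | .bridge j h => .inr ⟨j, h⟩
        invFun := fun x => match x with
          | .inl (.inl i) => .top i
          | .inl (.inr i) => .bot i
          | .inr j => .bridge j.1 j.2
        left_inv := by rintro (_ | _ | _) <;> rfl
        right_inv := by rintro ((_ | _) | _) <;> rfl }]
    simp
  have hV : Nat.card Γ.Vertex = 1 + (n + 1) + Nat.card P := by
    rw [Nat.card_congr (β := (Unit ⊕ Fin (n + 1)) ⊕ P)
      { toFun := fun e => match e with
          | .start => .inl (.inl ())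
          | .right i => .inl (.inr i)
          | .left j h => .inr ⟨j, h⟩
        invFun := fun x => match x with
          | .inl (.inl _) => .start
          | .inl (.inr i) => .right i
          | .inr j => .left j.1 j.2
        left_inv := by rintro (_ | _ | _) <;> rfl
        right_inv := by rintro ((_ | _) | _) <;> rfl }]
    simp
  change Nat.card Γ.Edge + 1 - Nat.card Γ.Vertex = n + 1
  omega

/-! ### Harmonic forms and the Jacobian -/

/-- The harmonic form that runs once around the `k`th cycle. -/
def cycleForm (k : Fin (n + 1)) : Γ.toMetricGraph.harmonicForms :=
  ⟨Γ.form k, by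
    classical
    intro v
    rw [sum_edges_eq Γ k, sum_edges_eq Γ k]
    · simp [add_comm]
    · intro e h1 h2; simp [form_eq_zero Γ h1 h2]
    · intro e h1 h2; simp [form_eq_zero Γ h1 h2]⟩

/-- Pairing with the differential of `coordV k` shows that the form agrees on the two edges of cycle
`k`; pairing with that of `rightOf j` shows that it vanishes on the bridge. -/
lemma harmonic_eq_sum (ω : Γ.toMetricGraph.harmonicForms) :
    ω = ∑ k, (ω : Γ.toMetricGraph.E → ℝ) (Γ.edgeTop k) • Γ.cycleForm k := by
  have hbot : ∀ k, (ω : Γ.toMetricGraph.E → ℝ) (Γ.edgeBot k) =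
      (ω : Γ.toMetricGraph.E → ℝ) (Γ.edgeTop k) := by
    intro k
    have h := sum_harmonic_mul_sub ω (Γ.coordV k)
    rw [sum_edges_eq Γ k] at h
    · simp only [tgt_edgeTop, src_edgeTop, tgt_edgeBot, src_edgeBot, coordV_vtxL, coordV_vtxR,
        le_refl, lt_irrefl, if_true, if_false] at h
      have := Γ.top_pos k
      refine mul_right_cancel₀ this.ne' ?_
      linarith
    · intro e h1 h2
      rw [coordV_tgt, coordV_src, coordE_eq, form_eq_zero Γ h1 h2]
      simp [h2]
  have hbridge : ∀ j h, (ω : Γ.toMetricGraph.E → ℝ) (Γ.edgeBridge j h) = 0 := by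
    intro j hj
    have h := sum_harmonic_mul_sub ω (Γ.rightOf j)
    rw [Finset.sum_eq_single (Γ.edgeBridge j hj)] at h
    · simpa [rightOf_vtxL Γ hj] using h
    · intro e _ he
      induction e using edge_cases with
      | top i => simp [rightOf_vtxL Γ hj]
      | bot i => simp [rightOf_vtxL Γ hj]
      | bridge j' h' =>
        have h1 : ¬ j' = j := by simpa using he
        have h2 : j.succ ≤ j'.castSucc ↔ j ≤ j' := by
          have : (j' : ℕ) ≠ j := fun h3 => h1 (Fin.ext h3)
          rw [Fin.le_def, Fin.le_def]
          simp only [Fin.val_succ, Fin.val_castSucc]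
          omega
        simp [rightOf_vtxL Γ hj, h2]
    · simp
  ext e
  have hsum : (((∑ k, (ω : Γ.toMetricGraph.E → ℝ) (Γ.edgeTop k) • Γ.cycleForm k :
      Γ.toMetricGraph.harmonicForms)) : Γ.toMetricGraph.E → ℝ) e =
      ∑ k, (ω : Γ.toMetricGraph.E → ℝ) (Γ.edgeTop k) * Γ.form k e := by
    simp [cycleForm, Finset.sum_apply]
  rw [hsum]
  induction e using edge_cases with
  | top i => simp
  | bot i => simp [hbot]
  | bridge j h => simp [hbridge]

/-- A linear functional on the harmonic forms is given by its values on the cycles. -/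
noncomputable def dualEquiv :
    StrongDual ℝ Γ.toMetricGraph.harmonicForms ≃L[ℝ] (Fin (n + 1) → ℝ) :=
  let f : StrongDual ℝ Γ.toMetricGraph.harmonicForms →ₗ[ℝ] (Fin (n + 1) → ℝ) :=
    { toFun := fun φ k => φ (Γ.cycleForm k)
      map_add' := fun _ _ => rfl
      map_smul' := fun _ _ => rfl }
  have hf : Function.Injective f := by
    intro φ ψ h
    ext ω
    rw [Γ.harmonic_eq_sum ω, map_sum, map_sum]
    refine Finset.sum_congr rfl fun k _ => ?_
    rw [map_smul, map_smul]
    exact congrArg _ (congrFun h k)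
  have hs : Function.Surjective f := by
    intro a
    let g : Γ.toMetricGraph.harmonicForms →ₗ[ℝ] ℝ :=
      { toFun := fun ω => ∑ k, a k * (ω : Γ.toMetricGraph.E → ℝ) (Γ.edgeTop k)
        map_add' := fun ω ω' => by simp [mul_add, Finset.sum_add_distrib]
        map_smul' := fun c ω => by
          simp only [Submodule.coe_smul, Pi.smul_apply, smul_eq_mul, RingHom.id_apply,
            Finset.mul_sum]
          exact Finset.sum_congr rfl fun k _ => by ring }
    refine ⟨LinearMap.toContinuousLinearMap g, ?_⟩
    ext k
    change ∑ i, a i * Γ.form k (Γ.edgeTop i) = a k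
    simp
  have : FiniteDimensional ℝ (StrongDual ℝ Γ.toMetricGraph.harmonicForms) :=
    FiniteDimensional.of_injective f hf
  LinearEquiv.toContinuousLinearEquiv (𝕜 := ℝ)
    (E := StrongDual ℝ Γ.toMetricGraph.harmonicForms) (F := Fin (n + 1) → ℝ)
    (LinearEquiv.ofBijective f ⟨hf, hs⟩)

lemma dualEquiv_apply (φ : StrongDual ℝ Γ.toMetricGraph.harmonicForms) (k : Fin (n + 1)) :
    Γ.dualEquiv φ k = φ (Γ.cycleForm k) := rfl

/-- Along an edge `coordE k` is a primitive of the form, and it differs from the true coordinate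
only at the end of the bottom edge, by a period. -/
lemma abelJacobi_chainBoundary (c : Γ.toMetricGraph.Segment →₀ ℤ) (k : Fin (n + 1)) :
    Γ.abelJacobi k (chainBoundary c) - chainIntegral c (Γ.cycleForm k) ∈
      AddSubgroup.zmultiples (Γ.circ k) := by
  classical
  have hpt : ∀ (e : Γ.toMetricGraph.E) (t : ℝ), t ∈ Set.Icc 0 (Γ.toMetricGraph.len e) →
      Γ.coord k (Γ.toMetricGraph.pt e t) - Γ.coordE k e t ∈ AddSubgroup.zmultiples (Γ.circ k) := by
    rintro e t ⟨h0, h1⟩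
    rcases h1.lt_or_eq with h1 | rfl
    · rw [coord_pt Γ k e h0 h1, sub_self]
      exact zero_mem _
    · rw [pt_of_len_le e le_rfl, coord, coordV_tgt]
      split_ifs
      · rw [sub_sub_cancel_left]
        exact neg_mem (AddSubgroup.mem_zmultiples _)
      · simp
  rw [chainBoundary, chainIntegral, Finsupp.sum, Finsupp.sum, map_sum, ← Finset.sum_sub_distrib]
  refine sum_mem fun s _ => ?_
  have h := zsmul_mem (sub_mem (hpt s.e s.b s.hb) (hpt s.e s.a s.ha)) (c s)
  convert h using 1
  rw [map_zsmul, map_sub, abelJacobi_single, abelJacobi_single, coordE_eq Γ k s.e s.b,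
    coordE_eq Γ k s.e s.a]
  simp only [cycleForm, zsmul_eq_mul]
  push_cast
  ring

lemma chainIntegral_eq_sum (c : Γ.toMetricGraph.Segment →₀ ℤ)
    (ω : Γ.toMetricGraph.harmonicForms) : chainIntegral c ω =
      ∑ k, (ω : Γ.toMetricGraph.E → ℝ) (Γ.edgeTop k) * chainIntegral c (Γ.cycleForm k) := by
  have h : ∀ e, (ω : Γ.toMetricGraph.E → ℝ) e =
      ∑ k, (ω : Γ.toMetricGraph.E → ℝ) (Γ.edgeTop k) * Γ.form k e := by
    intro e
    conv_lhs => rw [Γ.harmonic_eq_sum ω]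
    simp [cycleForm, Finset.sum_apply]
  simp only [chainIntegral, Finsupp.sum, Finset.mul_sum]
  rw [Finset.sum_comm]
  refine Finset.sum_congr rfl fun s _ => ?_
  rw [h s.e, Finset.mul_sum, Finset.mul_sum]
  refine Finset.sum_congr rfl fun k _ => ?_
  simp only [cycleForm]
  ring

/-- On each cycle a segment of the top edge, repeated `N` times with sign, has any prescribed
integral once `N` is large. -/
lemma exists_chain (a : Fin (n + 1) → ℝ) : ∃ c : Γ.toMetricGraph.Segment →₀ ℤ,
    ∀ k, chainIntegral c (Γ.cycleForm k) = a k := by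
  have h1 : ∀ k, ∃ (N : ℤ) (s : ℝ), s ∈ Set.Icc 0 (Γ.top k) ∧ N * s = a k := by
    intro k
    have htop := Γ.top_pos k
    have hM : |a k| / Γ.top k < (⌊|a k| / Γ.top k⌋₊ + 1 : ℕ) := by
      push_cast
      exact Nat.lt_floor_add_one _
    set M := ⌊|a k| / Γ.top k⌋₊ + 1
    have hM0 : (0 : ℝ) < M := lt_of_le_of_lt (by positivity) hM
    have hs : |a k| / M ∈ Set.Icc 0 (Γ.top k) := by
      refine ⟨by positivity, ?_⟩
      rw [div_le_iff₀ hM0]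
      rw [div_lt_iff₀ htop] at hM
      linarith
    rcases abs_choice (a k) with h | h
    · refine ⟨M, |a k| / M, hs, ?_⟩
      rw [h]
      push_cast
      field_simp
    · refine ⟨-M, |a k| / M, hs, ?_⟩
      rw [h]
      push_cast
      field_simp
  choose N s hs hN using h1
  let seg : Fin (n + 1) → Γ.toMetricGraph.Segment := fun k =>
    ⟨Γ.edgeTop k, 0, s k, ⟨le_rfl, (Γ.top_pos k).le⟩, hs k⟩
  refine ⟨∑ k, Finsupp.single (seg k) (N k), fun k => ?_⟩
  rw [chainIntegral, ← Finsupp.sum_finsetSum_index]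
  · rw [Finset.sum_eq_single k]
    · rw [Finsupp.sum_single_index (by simp)]
      simp [seg, cycleForm, hN]
    · intro i _ hi
      rw [Finsupp.sum_single_index (by simp)]
      simp [seg, cycleForm, hi.symm]
    · simp
  · simp
  · intro _ _ _
    push_cast; ring

/-- The Brill-Noether locus in the coordinates of the universal cover of the Jacobian. -/
def coordLocus (lam : YoungDiagram) : Set (Fin (n + 1) → ℝ) :=
  {a | ∀ i j : ℕ, (i, j) ∈ lam → InDiagram Γ.periods Γ.tops (n + 1) (extend a) i j}

lemma coordLocus_congr {lam : YoungDiagram} {a b : Fin (n + 1) → ℝ} (ha : a ∈ Γ.coordLocus lam)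
    (hab : ∀ k, b k - a k ∈ AddSubgroup.zmultiples (Γ.circ k)) : b ∈ Γ.coordLocus lam :=
  fun i j hij => (ha i j hij).congr fun _ _ => hab _

lemma mk_mem_brillNoetherLocus_iff (lam : YoungDiagram) (D : Γ.toMetricGraph.Div0) :
    (QuotientAddGroup.mk D : Γ.toMetricGraph.Pic0) ∈ brillNoetherLocus Γ.markedPoint lam ↔
      (fun k => Γ.abelJacobi k D) ∈ Γ.coordLocus lam := by
  have key : ∀ D : Γ.toMetricGraph.Div0, (∀ i j : ℕ, (i, j) ∈ lam → RankAtLeast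
      ((D : Γ.toMetricGraph.Div) +
        Finsupp.single Γ.markedPoint ((Γ.toMetricGraph.genus : ℤ) + i - j - 1)) i) ↔
      (fun k => Γ.abelJacobi k D) ∈ Γ.coordLocus lam := by
    intro D
    refine forall_congr' fun i => forall_congr' fun j => forall_congr' fun _ => ?_
    rw [rankAtLeast_iff Γ _ D.2, genus_toMetricGraph, ← rankGE_iff_inDiagram Γ.periods_ne_top]
  constructor
  · rintro ⟨D', hD', h⟩
    refine Γ.coordLocus_congr ((key D').1 h) fun k => ?_
    have h1 := QuotientAddGroup.eq.1 hD'
    have h2 := (Γ.mem_principal_iff.1 (AddSubgroup.mem_addSubgroupOf.1 h1)).2 k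
    convert h2 using 1
    push_cast
    rw [map_add, map_neg]
    ring
  · exact fun h => ⟨D, rfl, (key D).2 h⟩

lemma exists_div0 (a : Fin (n + 1) → ℝ) :
    ∃ (c : Γ.toMetricGraph.Segment →₀ ℤ) (D : Γ.toMetricGraph.Div0),
      chainBoundary c = (D : Γ.toMetricGraph.Div) ∧
      (∀ k, chainIntegral c (Γ.cycleForm k) = a k) ∧
      ∀ k, Γ.abelJacobi k D - a k ∈ AddSubgroup.zmultiples (Γ.circ k) := by
  obtain ⟨c, hc⟩ := Γ.exists_chain a
  exact ⟨c, ⟨chainBoundary c, deg_chainBoundary c⟩, rfl, hc,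
    fun k => hc k ▸ Γ.abelJacobi_chainBoundary c k⟩

lemma brillNoetherLocus_nonempty_iff (lam : YoungDiagram) :
    (brillNoetherLocus Γ.markedPoint lam).Nonempty ↔ (Γ.coordLocus lam).Nonempty := by
  constructor
  · rintro ⟨x, hx⟩
    obtain ⟨D, rfl⟩ := QuotientAddGroup.mk_surjective x
    exact ⟨_, (Γ.mk_mem_brillNoetherLocus_iff lam D).1 hx⟩
  · rintro ⟨a, ha⟩
    obtain ⟨c, D, -, -, hD⟩ := Γ.exists_div0 a
    exact ⟨_, (Γ.mk_mem_brillNoetherLocus_iff lam D).2 (Γ.coordLocus_congr ha hD)⟩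

lemma jacobianLift_brillNoetherLocus (lam : YoungDiagram) :
    jacobianLift (brillNoetherLocus Γ.markedPoint lam) = Γ.dualEquiv ⁻¹' Γ.coordLocus lam := by
  ext φ
  constructor
  · rintro ⟨c, D, hc, hD, hφ⟩
    refine Γ.coordLocus_congr ((Γ.mk_mem_brillNoetherLocus_iff lam D).1 hD) fun k => ?_
    rw [dualEquiv_apply, hφ, ← hc, ← neg_sub]
    exact neg_mem (Γ.abelJacobi_chainBoundary c k)
  · intro hφ
    obtain ⟨c, D, hc, hint, hD⟩ := Γ.exists_div0 (Γ.dualEquiv φ)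
    refine ⟨c, D, hc, (Γ.mk_mem_brillNoetherLocus_iff lam D).2 (Γ.coordLocus_congr hφ hD),
      fun ω => ?_⟩
    rw [chainIntegral_eq_sum]
    conv_lhs => rw [Γ.harmonic_eq_sum ω]
    rw [map_sum]
    refine Finset.sum_congr rfl fun k _ => ?_
    rw [map_smul, hint, dualEquiv_apply, smul_eq_mul]

lemma picDim_brillNoetherLocus (lam : YoungDiagram) :
    picDim (brillNoetherLocus Γ.markedPoint lam) = dimH (Γ.coordLocus lam) := by
  rw [picDim, jacobianLift_brillNoetherLocus]
  exact ContinuousLinearEquiv.dimH_preimage (𝕜 := ℝ)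
    (E := StrongDual ℝ Γ.toMetricGraph.harmonicForms) (F := Fin (n + 1) → ℝ) Γ.dualEquiv _

/-! ### Dimensions of Brill-Noether loci -/

/-- Only the coordinates at entries of the tableau are constrained; the others are free. -/
lemma affine_subset_coordLocus {lam : YoungDiagram} (t : ℕ → ℕ → ℕ)
    (hg : ∀ i j, (i, j) ∈ lam → t i j < n + 1)
    (hrow : ∀ i j, (i, j + 1) ∈ lam → t i j < t i (j + 1))
    (hcol : ∀ i j, (i + 1, j) ∈ lam → t i j < t (i + 1) j)
    (K : Finset (Fin (n + 1))) (hK : ∀ i j, (i, j) ∈ lam → Fin.ofNat (n + 1) (t i j) ∈ K)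
    (c : Fin (n + 1) → ℝ) (hc : ∀ i j, (i, j) ∈ lam →
      extend c (t i j) + ((t i j : ℤ) + i - j) • Γ.tops (t i j) ∈ Γ.periods (t i j)) :
    {a | ∀ k ∈ K, a k = c k} ⊆ Γ.coordLocus lam := by
  intro a ha
  refine inDiagram_of_tableau t hg hrow hcol fun i j hij => ?_
  have : extend a (t i j) = extend c (t i j) := ha _ (hK i j hij)
  rw [this]
  exact hc i j hij

lemma le_dimH_coordLocus {lam : YoungDiagram} {K : Finset (Fin (n + 1))} {c : Fin (n + 1) → ℝ}
    (h : {a | ∀ k ∈ K, a k = c k} ⊆ Γ.coordLocus lam) {m : ℕ} (hm : K.card ≤ m) :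
    ((n + 1 - m : ℕ) : ENNReal) ≤ dimH (Γ.coordLocus lam) := by
  refine le_trans ?_ (dimH_mono h)
  rw [dimH_setOf_eq, Fintype.card_fin]
  exact_mod_cast Nat.sub_le_sub_left hm _

/-- The standard tableau by rows shows that the locus of a small partition is large. -/
lemma exists_affine_subset_coordLocus {lam : YoungDiagram} (hlam : lam.card ≤ n + 1) :
    ∃ (K : Finset (Fin (n + 1))) (c : Fin (n + 1) → ℝ), K.card ≤ lam.card ∧
      {a | ∀ k ∈ K, a k = c k} ⊆ Γ.coordLocus lam := by
  classical
  -- The number of boxes that precede `(i, j)` in reading order.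
  let t : ℕ → ℕ → ℕ := fun i j =>
    (lam.cells.filter fun b => toLex b < toLex (i, j)).card
  have hmono : ∀ i j i' j', (i, j) ∈ lam → toLex (i, j) < toLex (i', j') → t i j < t i' j' := by
    intro i j i' j' hij hlt
    refine Finset.card_lt_card (Finset.ssubset_iff_of_subset ?_ |>.2 ⟨(i, j), ?_, ?_⟩)
    · intro b hb
      rw [Finset.mem_filter] at hb ⊢
      exact ⟨hb.1, hb.2.trans hlt⟩
    · exact Finset.mem_filter.2 ⟨hij, hlt⟩
    · simp
  have hlt : ∀ i j, (i, j) ∈ lam → t i j < lam.card := by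
    intro i j hij
    refine Finset.card_lt_card (Finset.filter_ssubset.2 ⟨(i, j), hij, ?_⟩)
    simp
  have hinj : ∀ b ∈ lam.cells, ∀ b' ∈ lam.cells, t b.1 b.2 = t b'.1 b'.2 → b = b' := by
    rintro ⟨i, j⟩ hb ⟨i', j'⟩ hb' h
    rcases lt_trichotomy (toLex (i, j)) (toLex (i', j')) with h1 | h1 | h1
    · exact absurd h (hmono i j i' j' hb h1).ne
    · exact toLex.injective h1
    · exact absurd h.symm (hmono i' j' i j hb' h1).ne
  -- The coordinate that puts the unique box with entry `k` into the residue class of cycle `k`.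
  let c : Fin (n + 1) → ℝ := fun k =>
    if h : ∃ b ∈ lam.cells, t b.1 b.2 = k then
      -(((k : ℤ) + h.choose.1 - h.choose.2) • Γ.top k) else 0
  refine ⟨lam.cells.image fun b => Fin.ofNat (n + 1) (t b.1 b.2), c, Finset.card_image_le,
    Γ.affine_subset_coordLocus t (fun i j hij => (hlt i j hij).trans_le hlam) ?_ ?_ _ ?_ c ?_⟩
  · intro i j hij
    refine hmono _ _ _ _ (lam.up_left_mem le_rfl (Nat.le_succ j) hij) ?_
    exact Prod.Lex.toLex_lt_toLex.2 (Or.inr ⟨rfl, Nat.lt_succ_self j⟩)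
  · intro i j hij
    refine hmono _ _ _ _ (lam.up_left_mem (Nat.le_succ i) le_rfl hij) ?_
    exact Prod.Lex.toLex_lt_toLex.2 (Or.inl (Nat.lt_succ_self i))
  · intro i j hij
    exact Finset.mem_image.2 ⟨(i, j), hij, rfl⟩
  · intro i j hij
    have hk : ((Fin.ofNat (n + 1) (t i j) : Fin (n + 1)) : ℕ) = t i j :=
      Nat.mod_eq_of_lt ((hlt i j hij).trans_le hlam)
    have hex : ∃ b ∈ lam.cells, t b.1 b.2 = (Fin.ofNat (n + 1) (t i j) : Fin (n + 1)) :=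
      ⟨(i, j), hij, hk.symm⟩
    have hch : hex.choose = (i, j) :=
      hinj _ hex.choose_spec.1 _ hij (hex.choose_spec.2.trans hk)
    have : extend c (t i j) + ((t i j : ℤ) + i - j) • Γ.tops (t i j) = 0 := by
      have hc : c (Fin.ofNat (n + 1) (t i j)) =
          -(((t i j : ℤ) + i - j) • Γ.top (Fin.ofNat (n + 1) (t i j))) := by
        simp only [c]
        rw [dif_pos hex, hch, hk]
      rw [extend, tops, hc, neg_add_cancel]
    rw [this]
    exact zero_mem _

/-- If the torsion orders are large, then the locus lies in countably many affine subspaces of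
codimension the size of the partition. -/
lemma coordLocus_subset_iUnion
    (hτ : ∀ k < n + 1, ∀ c : ℤ, c ≠ 0 → c • Γ.tops k ∈ Γ.periods k → (k : ℤ) + 2 ≤ |c|)
    (lam : YoungDiagram) : Γ.coordLocus lam ⊆
      ⋃ (t : lam.cells ↪ Fin (n + 1)) (z : Fin (n + 1) → ℤ) (d : Fin (n + 1) → ℤ),
        {a | ∀ k ∈ Finset.univ.map t, a k = z k • Γ.circ k - d k • Γ.top k} := by
  classical
  intro a ha
  obtain ⟨t, ht, hta⟩ := exists_injective_tableau Γ.periods_ne_top hτ ha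
  have h1 : ∀ b : lam.cells, ∃ z : ℤ, a (t b) =
      z • Γ.circ (t b) - ((t b : ℤ) + b.1.1 - b.1.2) • Γ.top (t b) := by
    intro b
    have h2 := hta b
    rw [extend_val, tops_val, periods_val] at h2
    obtain ⟨z, hz⟩ := AddSubgroup.mem_zmultiples_iff.1 h2
    exact ⟨z, by rw [hz, add_sub_cancel_right]⟩
  choose z hz using h1
  simp only [Set.mem_iUnion]
  refine ⟨⟨t, ht⟩, fun k => if h : ∃ b, t b = k then z h.choose else 0,
    fun k => if h : ∃ b, t b = k then (t h.choose : ℤ) + h.choose.1.1 - h.choose.1.2 else 0, ?_⟩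
  intro k hk
  obtain ⟨b, -, rfl⟩ := Finset.mem_map.1 hk
  have hex : ∃ b', t b' = t b := ⟨b, rfl⟩
  have hch : hex.choose = b := ht hex.choose_spec
  simp only [Function.Embedding.coeFn_mk]
  rw [dif_pos hex, dif_pos hex, hch]
  exact hz b

/-- The subspaces are indexed by a finite set of embeddings and by integer vectors, so the union is
countable and its dimension is the supremum of theirs. -/
lemma dimH_coordLocus_le
    (hτ : ∀ k < n + 1, ∀ c : ℤ, c ≠ 0 → c • Γ.tops k ∈ Γ.periods k → (k : ℤ) + 2 ≤ |c|)
    (lam : YoungDiagram) : dimH (Γ.coordLocus lam) ≤ ((n + 1 - lam.card : ℕ) : ENNReal) := by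
  refine (dimH_mono (Γ.coordLocus_subset_iUnion hτ lam)).trans ?_
  simp only [dimH_iUnion, iSup_le_iff]
  intro t z d
  rw [dimH_setOf_eq, Finset.card_map, Finset.card_univ, Fintype.card_coe, Fintype.card_fin]

/-! ### Torsion orders -/

lemma torsionOrder_smul_mem {i : Fin (n + 1)} (h : Γ.torsionOrder i ≠ 0) :
    (Γ.torsionOrder i : ℤ) • Γ.top i ∈ AddSubgroup.zmultiples (Γ.circ i) := by
  unfold torsionOrder at h ⊢
  split_ifs at h ⊢ with hirr
  · exact absurd rfl h
  · obtain ⟨-, z, hz⟩ := Nat.sInf_mem (Nat.nonempty_of_pos_sInf (Nat.pos_of_ne_zero h))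
    refine AddSubgroup.mem_zmultiples_iff.2 ⟨z, ?_⟩
    simp only [zsmul_eq_mul]
    rw [circ, ← hz]
    push_cast
    rfl

lemma torsionOrder_le {i : Fin (n + 1)} {c : ℤ} (hc : c ≠ 0)
    (h : c • Γ.top i ∈ AddSubgroup.zmultiples (Γ.circ i)) :
    Γ.torsionOrder i ≠ 0 ∧ (Γ.torsionOrder i : ℤ) ≤ |c| := by
  obtain ⟨z, hz⟩ := AddSubgroup.mem_zmultiples_iff.1 h
  simp only [zsmul_eq_mul] at hz
  have hcirc := Γ.circ_pos i
  have hc' : (c : ℝ) ≠ 0 := by exact_mod_cast hc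
  have hrat : ¬ Irrational (Γ.top i / (Γ.top i + Γ.bot i)) := by
    rw [Irrational, not_not]
    refine ⟨(z : ℚ) / c, ?_⟩
    push_cast
    change _ = Γ.top i / Γ.circ i
    rw [div_eq_div_iff hc' hcirc.ne']
    linarith
  have hmem : c.natAbs ∈
      {m : ℕ | 0 < m ∧ ∃ k : ℤ, (m : ℝ) * Γ.top i = k * (Γ.top i + Γ.bot i)} := by
    refine ⟨Int.natAbs_pos.2 hc, ?_⟩
    rcases Int.natAbs_eq c with h1 | h1
    · refine ⟨z, ?_⟩
      have : (c : ℝ) = c.natAbs := by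
        have := congrArg (Int.cast : ℤ → ℝ) h1
        rwa [Int.cast_natCast] at this
      rw [← this, ← hz]
      exact hz.symm ▸ rfl
    · refine ⟨-z, ?_⟩
      have : (c : ℝ) = -c.natAbs := by
        have := congrArg (Int.cast : ℤ → ℝ) h1
        push_cast at this
        simpa using this
      rw [this] at hz
      change _ = _ * Γ.circ i
      push_cast
      linarith
  rw [torsionOrder, if_neg hrat]
  refine ⟨(Nat.sInf_mem ⟨_, hmem⟩).1.ne', ?_⟩
  rw [Int.abs_eq_natAbs]
  exact_mod_cast Nat.sInf_le hmem

/-- The partition with rows of lengths `m` and `1`. -/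
def hook (m : ℕ) (hm : 0 < m) : YoungDiagram where
  cells := insert (1, 0) ((Finset.range m).image fun j => (0, j))
  isLowerSet := by
    rintro ⟨i, j⟩ ⟨i', j'⟩ h hij
    obtain ⟨h1, h2⟩ := Prod.mk_le_mk.1 h
    simp at hij ⊢
    omega

lemma mem_hook {m : ℕ} {hm : 0 < m} {i j : ℕ} :
    (i, j) ∈ hook m hm ↔ (i = 1 ∧ j = 0) ∨ (i = 0 ∧ j < m) := by
  rw [← YoungDiagram.mem_cells]
  simp [hook]
  omega

lemma card_hook (m : ℕ) (hm : 0 < m) : (hook m hm).card = m + 1 := by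
  rw [YoungDiagram.card, hook, Finset.card_insert_of_notMem (by simp),
    Finset.card_image_of_injective _ fun a b h => by simpa using h, Finset.card_range]

/-- A cycle of small torsion order makes the locus of a hook too large. -/
lemma exists_affine_subset_coordLocus_hook {k : Fin (n + 1)} {m : ℕ} (hm : 2 ≤ m)
    (hmk : m ≤ k + 1) (h : (m : ℤ) • Γ.top k ∈ AddSubgroup.zmultiples (Γ.circ k)) :
    ∃ (K : Finset (Fin (n + 1))) (c : Fin (n + 1) → ℝ), K.card ≤ m ∧
      {a | ∀ k ∈ K, a k = c k} ⊆ Γ.coordLocus (hook m (by omega)) := by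
  classical
  -- Cycle `k` takes both corners `(1, 0)` and `(0, m - 1)`. The remaining `m - 1` boxes go to
  -- cycles `0, ..., m - 2`, which precede `k` because `m ≤ k + 1`.
  let t : ℕ → ℕ → ℕ := fun i j => if i = 0 ∧ j < m - 1 then j else k
  have hk := k.2
  have ht0 : ∀ j, j < m - 1 → t 0 j = j := fun j hj => by simp [t, hj]
  have ht2 : t 1 0 = k := by simp [t]
  -- The value at `k` makes the term of `(1, 0)` zero and that of `(0, m - 1)` equal to `-m • top
  -- k`, a period. A box `(0, j)` on cycle `j` has coefficient `j + 0 - j = 0`, so 0 works there.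
  let c : Fin (n + 1) → ℝ := fun i => if i = k then -(((k : ℤ) + 1) • Γ.top k) else 0
  have hofNat : ∀ j, j < n + 1 → ((Fin.ofNat (n + 1) j : Fin (n + 1)) : ℕ) = j :=
    fun j hj => Nat.mod_eq_of_lt hj
  refine ⟨insert k ((Finset.range (m - 1)).image (Fin.ofNat (n + 1))), c, ?_,
    Γ.affine_subset_coordLocus t ?_ ?_ ?_ _ ?_ c ?_⟩
  · refine (Finset.card_insert_le _ _).trans ?_
    have := Finset.card_image_le (s := Finset.range (m - 1)) (f := Fin.ofNat (n + 1))
    rw [Finset.card_range] at this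
    omega
  · intro i j _
    simp only [t]
    split_ifs <;> omega
  · intro i j hij
    rw [mem_hook] at hij
    obtain ⟨rfl, hj⟩ : i = 0 ∧ j + 1 < m := by omega
    rw [ht0 j (by omega)]
    simp only [t]
    split_ifs <;> omega
  · intro i j hij
    rw [mem_hook] at hij
    obtain ⟨rfl, rfl⟩ : i = 0 ∧ j = 0 := by omega
    rw [ht0 0 (by omega), ht2]
    omega
  · intro i j hij
    simp only [t]
    split_ifs with h1
    · exact Finset.mem_insert_of_mem (Finset.mem_image_of_mem _ (Finset.mem_range.2 h1.2))
    · rw [Fin.ofNat_val_eq_self]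
      exact Finset.mem_insert_self _ _
  · intro i j hij
    rw [mem_hook] at hij
    by_cases h1 : i = 0 ∧ j < m - 1
    · obtain ⟨rfl, hj⟩ := h1
      rw [ht0 j hj]
      have hne : Fin.ofNat (n + 1) j ≠ k := fun h2 => by
        have := congrArg Fin.val h2
        rw [hofNat j (by omega)] at this
        omega
      have h0 : extend c j = 0 := if_neg hne
      simp [h0]
    · have h2 : t i j = k := by simp only [t, if_neg h1]
      rw [h2, extend_val, tops_val, periods_val]
      simp only [c, if_true]
      rcases hij with ⟨rfl, rfl⟩ | ⟨rfl, hj⟩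
      · simp
      · obtain rfl : j = m - 1 := by omega
        have h3 : -(((k : ℤ) + 1) • Γ.top k) +
            (((k : ℕ) : ℤ) + ((0 : ℕ) : ℤ) - ((m - 1 : ℕ) : ℤ)) • Γ.top k =
              -((m : ℤ) • Γ.top k) := by
          rw [← neg_smul, ← add_smul, ← neg_smul]
          congr 1
          push_cast [show 1 ≤ m by omega]
          ring
        rw [h3]
        exact neg_mem h

end ChainOfCycles

/-- Let `Γ` be a chain of `g = n + 1` cycles, with marked point `w_g` on the rightmost cycle.
The cycles are counted from `0` here, so the `i`th one is the cycle number `i + 1`. -/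
theorem theorem1p2 {n : ℕ} (Γ : ChainOfCycles n) :
    Γ.toMetricGraph.IsBrillNoetherGeneral Γ.markedPoint ↔
      ∀ i : Fin (n + 1), 2 ≤ (i : ℕ) + 1 →
        Γ.torsionOrder i = 0 ∨ (i : ℕ) + 1 < Γ.torsionOrder i := by
  constructor
  · intro h i _
    by_contra! hcon
    obtain ⟨h0, hle⟩ := hcon
    have hmem := Γ.torsionOrder_smul_mem h0
    have h1 := Γ.mem_zmultiples_top hmem
    set m := Γ.torsionOrder i
    have hm : 2 ≤ m := by
      rw [Nat.abs_cast] at h1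
      omega
    obtain ⟨K, c, hK, hsub⟩ := Γ.exists_affine_subset_coordLocus_hook hm hle hmem
    have hi := i.2
    have hlam := h (ChainOfCycles.hook m (by omega))
    rw [Γ.genus_toMetricGraph, ChainOfCycles.card_hook] at hlam
    -- The hook has `m + 1` boxes, but its locus contains a subspace of codimension at most `m`: it
    -- is either too large or nonempty where it should be empty.
    rcases le_or_gt (m + 1) (n + 1) with hg | hg
    · have h2 := (hlam.1 hg).2
      rw [Γ.picDim_brillNoetherLocus] at h2
      have h3 := Γ.le_dimH_coordLocus hsub hK
      rw [h2] at h3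
      have h4 : n + 1 - m ≤ n + 1 - (m + 1) := by exact_mod_cast h3
      omega
    · have h2 := (Γ.brillNoetherLocus_nonempty_iff (ChainOfCycles.hook m (by omega))).2
        ⟨c, hsub fun _ _ => rfl⟩
      exact h2.ne_empty (hlam.2 hg)
  · intro h lam
    have hτ : ∀ k < n + 1, ∀ c : ℤ, c ≠ 0 → c • Γ.tops k ∈ Γ.periods k → (k : ℤ) + 2 ≤ |c| := by
      intro k hk c hc hmem
      obtain ⟨k, rfl⟩ : ∃ i : Fin (n + 1), (i : ℕ) = k := ⟨⟨k, hk⟩, rfl⟩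
      rw [Γ.tops_val, Γ.periods_val] at hmem
      have h1 := Γ.mem_zmultiples_top hmem
      have h2 := Γ.torsionOrder_le hc hmem
      have h3 := abs_pos.2 hc
      -- On the first cycle the required bound is only `2 ≤ |c|`, which already follows from `v ≠
      -- w`.
      by_cases hk0 : (k : ℕ) = 0
      · omega
      · rcases h k (by omega) with h4 | h4
        · exact absurd h4 h2.1
        · omega
    rw [Γ.genus_toMetricGraph, Γ.picDim_brillNoetherLocus, Γ.brillNoetherLocus_nonempty_iff]
    refine ⟨fun hlam => ?_, fun hlam => ?_⟩
    · obtain ⟨K, c, hK, hsub⟩ := Γ.exists_affine_subset_coordLocus hlam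
      exact ⟨⟨c, hsub fun _ _ => rfl⟩,
        le_antisymm (Γ.dimH_coordLocus_le hτ lam) (Γ.le_dimH_coordLocus hsub hK)⟩
    · rw [← Set.not_nonempty_iff_eq_empty, Γ.brillNoetherLocus_nonempty_iff]
      rintro ⟨a, ha⟩
      obtain ⟨t, ht, -⟩ := ChainClass.exists_injective_tableau Γ.periods_ne_top hτ ha
      have := Fintype.card_le_of_injective t ht
      rw [Fintype.card_coe, Fintype.card_fin] at this
      exact absurd this (not_le.2 hlam)
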